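/- **Setting.** There are $n\ge 1$ agents $N=\{1,\dots,n\}$ and a set $M$ of $m$ indivisible goods. Agent $i$ has value $v_{ij}\ge 0$ for good $j$ and additive values $v_i(S)=\sum_{j\in S}v_{ij}$ for bundles $S\subseteq M$. For a collection $\mathcal A$ of disjoint bundles, $v_i(\mathcal A)=\sum_{S\in\mathcal A}v_i(S)$. A sub-problem $(\mathcal A,N')$ is a collection of bundles matched with a group of agents, and a decomposition is a list of bundle- and agent-disjoint sub-problems. The share of agent $k$ is $v_k(M)/n$ (which is $1/n$ for valuations normalized to $v_k(M)=1$). **The PROPm algorithm** on $(N,M)$: 1. If there are no agents, return the empty allocation. Otherwise choose an arbitrary agent $i$, the divider. Sort the goods in non-decreasing order of value for $i$. For $k=1,\dots,n$, let $S_k$ be the longest prefix of the remaining goods $M\setminus(S_1\cup\dots\cup S_{k-1})$ with $v_i(S_k)\le \frac{1}{n-k+1}v_i(M\setminus (S_1\cup\dots\cup S_{k-1}))$. 2. Start with the empty decomposition $D$ and $N_R=N\setminus\{i\}$. For $t=1,\dots,n$: let $c$ be the number of $k\in N_R$ with $v_k(S_1\cup\dots\cup S_t)/t>v_k(M)/n$;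 while $c>0$ and fewer than $t$ agents participate in $D$, replace $D$ by UpdateDecomposition$(D)$, let $N_R$ be the agents of $N\setminus\{i\}$ not participating in $D$, and recompute $c$. If after this loop fewer than $t$ agents participate in $D$, give $S_t$ to the divider, solve recursively every sub-problem $(\mathcal A,N')$ of $D$ (goods $\bigcup\mathcal A$, agents $N'$) and the problem with goods $S_{t+1}\cup\dots\cup S_n$ and agents $N_R$ (in a recursive call, shares are taken with respect to the goods and the number of agents of that call), and return the combined allocation. **UpdateDecomposition** in iteration $t$: choose $k\in N_R$ with $v_k(S_1\cup\dots\cup S_t)/t>v_k(M)/n$. Form the directed graph whose vertices are the sub-problems of $D$, a vertex $w_\alpha$ (with agent $k$ only) and a vertex $w_\beta$ (with bundle $S_t$ only). There is an edge from $u$ to a sub-problem $(\mathcal A_w,N_w)$ if some agent $a$ of $u$ has $v_a(\mathcal A_w)/|N_w|\ge v_a(M)/n$, and an edge from $u$ to $w_\beta$ if some agent $a$ of $u$ has $v_a(S_t)\ge v_a(M)/n$; such an $a$ is responsible for the edge. Let $R$ be the set of vertices reachable from $w_\alpha$, computed by breadth-first search. - *Case 1:* if $w_\beta\in R$, then for each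 edge $(u,w)$ on a path from $w_\alpha$ to $w_\beta$ move a responsible agent from $u$ to $w$; $w_\beta$ becomes a sub-problem of $D$. - *Case 2:* otherwise, if some agent $i'$ of a vertex in $R$ has $v_{i'}(S_1\cup\dots\cup S_t)/t\le v_{i'}(M)/n$, make the analogous moves along a path from $w_\alpha$ to the vertex of $i'$, and remove $i'$ from the decomposition. - *Case 3:* otherwise merge all agents and all bundles of the vertices in $R$ (including agent $k$), together with $S_t$, into one sub-problem. **Cost.** The algorithm is implemented with linked lists, insertion sort, and breadth-first search. Each procedure call is charged one step, hence so is each visit of a list cell and each iteration of a loop; between two charges only boundedly many elementary operations (arithmetic operations and comparisons of numbers, look-ups of a value $v_{ij}$, list constructors, tests of equality of indices) take place. **Theorem (polynomial running time).** There is a polynomial $p$ in two variables with natural-number coefficients such that, for all $n\ge1$, all $m\ge 0$, all values $v_{ij}\ge0$, and every way of making the arbitrary choices (of the divider, of the agent $k$, of the responsible agents and of $i'$), the PROPm algorithm halts after at most $p(n,m)$ steps and returns an allocation, i.e. a partition of the $m$ goods into one (possibly empty) bundle for each of the $n$ agents. -/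

import Mathlib

noncomputable section

namespace PROPm

/-! ## Cost model

A computation of type `Comp α` is started at some clock reading and either runs forever (`none`) or
ends with a result and a later clock reading. Steps are charged by `tick`. Data are real numbers,
natural numbers, and immutable linked lists and records of data. Every procedure below is charged
one step per call, and so one step per list cell that it visits and per iteration of a loop; between
two charges only a bounded number of elementary operations happen: building or taking apart one
list cell or record, one look-up in the table of values, one arithmetic operation or comparison of
numbers, one test of equality of two indices. -/

/-- Computations with a step clock that may fail to halt. -/
abbrev Comp := StateT ℕ Option

/-- Advance the clock by one step. -/
def tick : Comp Unit := fun s => some ((), s + 1)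

/-- A computation that never halts. -/
def diverge {β : Type} : Comp β := fun _ => none

/-! ### List operations with their costs -/

/-- The length of a list. -/
def len {β : Type} : List β → Comp ℕ
  | [] => do
    tick
    return 0
  | _ :: l => do
    tick
    let k ← len l
    return k + 1

/-- The concatenation of two lists. -/
def append {β : Type} : List β → List β → Comp (List β)
  | [], l => do
    tick
    return l
  | x :: k, l => do
    tick
    let r ← append k l
    return x :: r

/-- The concatenation of a list of lists. -/
def concat {β : Type} : List (List β) → Comp (List β)
  | [] => do
    tick
    return []
  | x :: l => do
    tick
    let r ← concat l
    append x r

/-- The members of a list that pass a test, each test being charged for. -/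
def select {β : Type} (test : β → Comp Bool) : List β → Comp (List β)
  | [] => do
    tick
    return []
  | x :: l => do
    tick
    let b ← test x
    let r ← select test l
    return if b then x :: r else r

/-- Whether `a` occurs in a list. -/
def occurs {β : Type} [DecidableEq β] (a : β) : List β → Comp Bool
  | [] => do
    tick
    return false
  | x :: l => do
    tick
    if a = x then return true else occurs a l

/-- Remove the first occurrence of `a` from a list. -/
def remove {β : Type} [DecidableEq β] (a : β) : List β → Comp (List β)
  | [] => do
    tick
    return []
  | x :: l => do
    tick
    if a = x then
      return l
    else
      let r ← remove a l
      return x :: r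

/-- The entry at position `k` of the nonempty list `x :: l` (the last one if `k` is too large). -/
def entry {β : Type} : ℕ → β → List β → Comp β
  | 0, x, _ => do
    tick
    return x
  | _ + 1, x, [] => do
    tick
    return x
  | k + 1, _, y :: l => do
    tick
    entry k y l

/-- Choose an arbitrary entry of the nonempty list `x :: l`. The rule `pick` resolves all arbitrary
choices of a run: `pick s` is the position chosen if the choice is made at time `s`. The clock
advances with every choice, so every sequence of choices comes from some rule. -/
def choose {β : Type} (pick : ℕ → ℕ) (x : β) (l : List β) : Comp β := do
  let s ← get
  entry (pick s) x l

/-! ## Bundles and values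

There are `n` agents `Fin n` and `m` goods `Fin m`; agent `i` has value `v i j` for good `j`. -/

/-- A sub-problem: a collection of bundles of goods, matched with a group of agents. A list of
sub-problems is a decomposition. -/
structure Subproblem (n m : ℕ) where
  bundles : List (List (Fin m))
  agents : List (Fin n)

section Algorithm

variable {n m : ℕ} (v : Fin n → Fin m → ℝ) (pick : ℕ → ℕ)

/-- The value `v_i(S)` of a bundle. -/
def value (i : Fin n) : List (Fin m) → Comp ℝ
  | [] => do
    tick
    return 0
  | j :: S => do
    tick
    let x ← value i S
    return v i j + x

/-- The value `v_i(A)` of a collection of bundles. -/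
def valueBundles (i : Fin n) : List (List (Fin m)) → Comp ℝ
  | [] => do
    tick
    return 0
  | S :: A => do
    tick
    let x ← value v i S
    let y ← valueBundles i A
    return x + y

/-- With `M` the goods and `N` the number of agents of the current problem, whether
`v_k(A) / size ≥ v_k(M) / N`. For valuations with `v_k(M) = 1` the right side is `1 / N`. -/
def atLeastShare (M : List (Fin m)) (N : ℕ) (A : List (List (Fin m))) (size : ℕ) (k : Fin n) :
    Comp Bool := do
  tick
  let x ← valueBundles v k A
  let y ← value v k M
  return decide (y / (N : ℝ) ≤ x / (size : ℝ))

/-- Whether `v_k(A) / size > v_k(M) / N`. -/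
def aboveShare (M : List (Fin m)) (N : ℕ) (A : List (List (Fin m))) (size : ℕ) (k : Fin n) :
    Comp Bool := do
  tick
  let x ← valueBundles v k A
  let y ← value v k M
  return decide (y / (N : ℝ) < x / (size : ℝ))

/-- Whether `v_k(A) / size ≤ v_k(M) / N`. -/
def atMostShare (M : List (Fin m)) (N : ℕ) (A : List (List (Fin m))) (size : ℕ) (k : Fin n) :
    Comp Bool := do
  tick
  let x ← valueBundles v k A
  let y ← value v k M
  return decide (x / (size : ℝ) ≤ y / (N : ℝ))

/-! ## Stage 1: the divider's bundles -/

/-- Insert a good into a list of goods that is sorted by the values of `i`. -/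
def insertGood (i : Fin n) (g : Fin m) : List (Fin m) → Comp (List (Fin m))
  | [] => do
    tick
    return [g]
  | h :: l => do
    tick
    if v i g ≤ v i h then
      return g :: h :: l
    else
      let r ← insertGood i g l
      return h :: r

/-- Sort goods in non-decreasing order of their value for `i`. -/
def sortGoods (i : Fin n) : List (Fin m) → Comp (List (Fin m))
  | [] => do
    tick
    return []
  | g :: l => do
    tick
    let r ← sortGoods i l
    insertGood v i g r

/-- Split off the longest prefix whose value for `i`, added to `acc`, is at most `bound`. -/
def takePrefix (i : Fin n) (bound : ℝ) : ℝ → List (Fin m) → Comp (List (Fin m) × List (Fin m))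
  | _, [] => do
    tick
    return ([], [])
  | acc, g :: l => do
    tick
    if acc + v i g ≤ bound then
      let r ← takePrefix i bound (acc + v i g) l
      return (g :: r.1, r.2)
    else
      return ([], g :: l)

/-- Cut a sorted list of goods into `k` bundles: with `k` bundles still to be made, the next one is
the longest prefix of the remaining goods worth at most `1 / k` of their value for `i`. -/
def makeBundles (i : Fin n) : ℕ → List (Fin m) → Comp (List (List (Fin m)))
  | 0, _ => do
    tick
    return []
  | k + 1, l => do
    tick
    let x ← value v i l
    let r ← takePrefix v i (x / ((k + 1 : ℕ) : ℝ)) 0 l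
    let B ← makeBundles i k r.2
    return r.1 :: B

/-! ## The subroutine that updates a decomposition -/

/-- The agents that participate in a decomposition. -/
def agentsOf : List (Subproblem n m) → Comp (List (Fin n))
  | [] => do
    tick
    return []
  | P :: D => do
    tick
    let r ← agentsOf D
    append P.agents r

/-- Those of the given agents that do not participate in the decomposition `D`. -/
def nonParticipants (others : List (Fin n)) (D : List (Subproblem n m)) : Comp (List (Fin n)) := do
  tick
  let a ← agentsOf D
  select (fun k => do
    let b ← occurs k a
    return !b) others

/-- A vertex of the sub-problem graph. The vertex with `id = 0` is `w_α`, with the single agent `k`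
and no bundle. The vertex with `id = 1` is `w_β`, with the single bundle `S_t` and no agent. The
other vertices are the sub-problems of the decomposition, numbered from `2` on. -/
structure Vertex (n m : ℕ) where
  id : ℕ
  bundles : List (List (Fin m))
  agents : List (Fin n)

/-- Number the sub-problems of a decomposition, starting from `k`. -/
def number : ℕ → List (Subproblem n m) → Comp (List (Vertex n m))
  | _, [] => do
    tick
    return []
  | k, P :: D => do
    tick
    let r ← number (k + 1) D
    return ⟨k, P.bundles, P.agents⟩ :: r

/-- The agents of `u` that are responsible for an edge from `u` to `w`; the edge exists if and only
if there are any. An agent of `u` is responsible if her value for the bundles of `w`, divided by the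
number of agents of `w` (by `1` for `w_β`), is at least her share. No edge enters `w_α`. -/
def edgeAgents (M : List (Fin m)) (N : ℕ) (u w : Vertex n m) : Comp (List (Fin n)) := do
  tick
  if w.id = 0 then
    return []
  else
    let s ← len w.agents
    select (atLeastShare v M N w.bundles (if w.id = 1 then 1 else s)) u.agents

/-- The move of an agent from the vertex numbered `source` to the vertex numbered `target`. -/
structure Move (n : ℕ) where
  agent : Fin n
  source : ℕ
  target : ℕ

/-- A reached vertex, with the edges of a path from `w_α` to it; each edge is given as the move of
an agent that is responsible for it. -/
structure Reached (n m : ℕ) where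
  vertex : Vertex n m
  path : List (Move n)

/-- Split a list of vertices that have not been seen yet into the ones to which there is an edge
from the reached vertex `x`, and the others. -/
def expand (M : List (Fin m)) (N : ℕ) (x : Reached n m) :
    List (Vertex n m) → Comp (List (Reached n m) × List (Vertex n m))
  | [] => do
    tick
    return ([], [])
  | w :: l => do
    tick
    let E ← edgeAgents v M N x.vertex w
    let r ← expand M N x l
    match E with
    | [] => return (r.1, w :: r.2)
    | a :: E' =>
      let b ← choose pick a E'
      return (⟨w, ⟨b, x.vertex.id, w.id⟩ :: x.path⟩ :: r.1, r.2)

/-- Breadth-first search, given the queue, the vertices not seen yet and the vertices done with.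
Returns the vertices done with and the vertices never seen. The first argument bounds the number of
iterations: the search diverges if it is too small. -/
def search (M : List (Fin m)) (N : ℕ) : ℕ → List (Reached n m) → List (Vertex n m) →
    List (Reached n m) → Comp (List (Reached n m) × List (Vertex n m))
  | 0, _, _, _ => diverge
  | _ + 1, [], unseen, done => do
    tick
    return (done, unseen)
  | fuel + 1, x :: queue, unseen, done => do
    tick
    let r ← expand v pick M N x unseen
    let q ← append queue r.1
    search M N fuel q r.2 (x :: done)

/-- Perform one move of an agent. -/
def applyMove (e : Move n) : List (Vertex n m) → Comp (List (Vertex n m))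
  | [] => do
    tick
    return []
  | w :: V => do
    tick
    let r ← applyMove e V
    let out ← if w.id = e.source then remove e.agent w.agents else pure w.agents
    let both := if w.id = e.target then e.agent :: out else out
    return ⟨w.id, w.bundles, both⟩ :: r

/-- Perform all the moves along a path. -/
def applyMoves : List (Move n) → List (Vertex n m) → Comp (List (Vertex n m))
  | [], V => do
    tick
    return V
  | e :: p, V => do
    tick
    let W ← applyMove e V
    applyMoves p W

/-- The reached copies of `w_β` (there is at most one). -/
def reachedBeta (R : List (Reached n m)) : Comp (List (Reached n m)) :=
  select (fun x => do
    tick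
    return decide (x.vertex.id = 1)) R

/-- Attach a reached vertex to each of the given agents. -/
def pairWith (x : Reached n m) : List (Fin n) → Comp (List (Fin n × Reached n m))
  | [] => do
    tick
    return []
  | a :: l => do
    tick
    let r ← pairWith x l
    return (a, x) :: r

/-- The agents `i'` of reached vertices with `v_{i'}(A) / t` at most the share of `i'`, each with
her vertex. -/
def lowAgents (M : List (Fin m)) (N : ℕ) (A : List (List (Fin m))) (t : ℕ) :
    List (Reached n m) → Comp (List (Fin n × Reached n m))
  | [] => do
    tick
    return []
  | x :: R => do
    tick
    let a ← select (atMostShare v M N A t) x.vertex.agents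
    let p ← pairWith x a
    let r ← lowAgents M N A t R
    append p r

/-- Remove agent `a` from the vertex numbered `k`. -/
def dropAgent (a : Fin n) (k : ℕ) : List (Vertex n m) → Comp (List (Vertex n m))
  | [] => do
    tick
    return []
  | w :: V => do
    tick
    let r ← dropAgent a k V
    let out ← if w.id = k then remove a w.agents else pure w.agents
    return ⟨w.id, w.bundles, out⟩ :: r

/-- The vertices numbered `k` or higher, as sub-problems. -/
def subproblemsFrom (k : ℕ) : List (Vertex n m) → Comp (List (Subproblem n m))
  | [] => do
    tick
    return []
  | w :: V => do
    tick
    let r ← subproblemsFrom k V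
    return if k ≤ w.id then ⟨w.bundles, w.agents⟩ :: r else r

/-- Merge all the bundles and all the agents of the reached vertices. -/
def mergeReached : List (Reached n m) → Comp (Subproblem n m)
  | [] => do
    tick
    return ⟨[], []⟩
  | x :: R => do
    tick
    let P ← mergeReached R
    let A ← append x.vertex.bundles P.bundles
    let a ← append x.vertex.agents P.agents
    return ⟨A, a⟩

/-- The subroutine, in iteration `t`, for the decomposition `D`. Here `S` is the bundle `S_t`,
`A` consists of the bundles `S_1, …, S_t`, and `k` is an agent outside `D` with
`v_k(S_1 ∪ … ∪ S_t) / t` above her share. -/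
def updateDecomposition (fuel : ℕ) (M : List (Fin m)) (N : ℕ) (A : List (List (Fin m)))
    (S : List (Fin m)) (t : ℕ) (k : Fin n) (D : List (Subproblem n m)) :
    Comp (List (Subproblem n m)) := do
  tick
  let V ← number 2 D
  let α : Vertex n m := ⟨0, [], [k]⟩
  let β : Vertex n m := ⟨1, [S], []⟩
  let R ← search v pick M N fuel [⟨α, []⟩] (β :: V) []
  let B ← reachedBeta R.1
  match B with
  | y :: _ =>
    -- Case 1: shift agents along a path from `w_α` to `w_β`.
    let W ← applyMoves y.path (α :: β :: V)
    subproblemsFrom 1 W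
  | [] =>
    let L ← lowAgents v M N A t R.1
    match L with
    | y₀ :: L' =>
      -- Case 2: shift agents along a path to the vertex of some `i'`, and remove `i'`.
      let y ← choose pick y₀ L'
      let W ← applyMoves y.2.path (α :: β :: V)
      let W' ← dropAgent y.1 y.2.vertex.id W
      subproblemsFrom 2 W'
    | [] =>
      -- Case 3: merge everything reached, with agent `k` of `w_α` and with the bundle `S_t`.
      let P ← mergeReached R.1
      let rest ← subproblemsFrom 2 R.2
      return ⟨S :: P.bundles, P.agents⟩ :: rest

/-! ## Stage 2: the main algorithm -/

/-- The while loop of iteration `t`. The list `C` consists of the agents `k` of `NR` with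
`v_k(S_1 ∪ … ∪ S_t) / t` above their share, and its length is `c`; `others` are all the agents but
the divider. The first argument bounds the number of iterations: the loop diverges if it is too
small. -/
def whileLoop (M : List (Fin m)) (N : ℕ) (others : List (Fin n)) (A : List (List (Fin m)))
    (S : List (Fin m)) (t : ℕ) : ℕ → List (Subproblem n m) → List (Fin n) →
    Comp (List (Subproblem n m) × List (Fin n))
  | 0, _, _ => diverge
  | fuel + 1, D, NR => do
    tick
    let C ← select (aboveShare v M N A t) NR
    let a ← agentsOf D
    let d ← len a
    match C with
    | [] => return (D, NR)
    | k₀ :: C' =>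
      if d < t then
        let k ← choose pick k₀ C'
        let D' ← updateDecomposition v pick fuel M N A S t k D
        let NR' ← nonParticipants others D'
        whileLoop M N others A S t fuel D' NR'
      else
        return (D, NR)

/-- The bundle of the divider, the decomposition, the agents outside it, and the bundles after the
divider's bundle. -/
structure Split (n m : ℕ) where
  bundle : List (Fin m)
  decomposition : List (Subproblem n m)
  outside : List (Fin n)
  later : List (List (Fin m))

/-- The for loop, up to the iteration in which the divider receives a bundle. The arguments after
`others` are the bundles `S_t, …, S_n`, the number `t`, the bundles before `S_t`, the decomposition
`D` and the agents `NR` outside it. Running past the last bundle would return no allocation. -/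
def forLoop (fuel : ℕ) (M : List (Fin m)) (N : ℕ) (others : List (Fin n)) :
    List (List (Fin m)) → ℕ → List (List (Fin m)) → List (Subproblem n m) → List (Fin n) →
    Comp (Split n m)
  | [], _, _, _, _ => diverge
  | S :: later, t, before, D, NR => do
    tick
    let r ← whileLoop v pick M N others (S :: before) S t fuel D NR
    let a ← agentsOf r.1
    let d ← len a
    if d < t then
      return ⟨S, r.1, r.2, later⟩
    else
      forLoop fuel M N others later (t + 1) (S :: before) r.1 r.2

/-- Solve all sub-problems of a decomposition by the given procedure. -/
def solveAll (solveOne : List (Fin n) → List (Fin m) → Comp (List (Fin n × List (Fin m)))) :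
    List (Subproblem n m) → Comp (List (Fin n × List (Fin m)))
  | [] => do
    tick
    return []
  | P :: D => do
    tick
    let M ← concat P.bundles
    let x ← solveOne P.agents M
    let y ← solveAll solveOne D
    append x y

/-- The PROPm algorithm for the given agents and goods; the result lists each agent with her bundle.
The first argument bounds the depth of the recursion and the number of iterations of each loop: the
algorithm diverges if it is too small, and otherwise it does not influence the run. -/
def solve : ℕ → List (Fin n) → List (Fin m) → Comp (List (Fin n × List (Fin m)))
  | 0, _, _ => diverge
  | _ + 1, [], _ => do
    tick
    return []
  | fuel + 1, i₀ :: I, M => do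
    tick
    let i ← choose pick i₀ I
    let others ← remove i (i₀ :: I)
    let N ← len (i₀ :: I)
    let sorted ← sortGoods v i M
    let B ← makeBundles v i N sorted
    let r ← forLoop v pick fuel M N others B 1 [] [] others
    let left ← solveAll (solve fuel) r.decomposition
    let M' ← concat r.later
    let right ← solve fuel r.outside M'
    let x ← append left right
    return (i, r.bundle) :: x

/-- The run of the PROPm algorithm on the instance `v`, with arbitrary choices made by `pick`, halts
after exactly `steps` steps with the result `X`. -/
def RunsTo (X : List (Fin n × List (Fin m))) (steps : ℕ) : Prop :=
  ∃ fuel : ℕ, (solve v pick fuel (List.finRange n) (List.finRange m)).run 0 = some (X, steps)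

end Algorithm

/-- `X` is an allocation: every agent is listed exactly once, and every good is in exactly one of
the bundles, and only once. -/
def IsAllocation {n m : ℕ} (X : List (Fin n × List (Fin m))) : Prop :=
  (X.map Prod.fst).Perm (List.finRange n) ∧ (X.map Prod.snd).flatten.Perm (List.finRange m)

end PROPm

end

namespace PROPm

/-! Every procedure is given a specification `HaltsWithin b c P`, which bounds the steps from any
starting time and describes the result. These specifications compose along `bind`, so the proof
reduces to finding, for each loop, a quantity that bounds its iterations. One number `K` bounds the
agents, the goods, and the bundles of any collection that occurs; in the end `K = n + m`.

The while loop is controlled by the number of agents outside the decomposition who value the first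
`t` bundles above their share. An update starts from such an agent `k`. In Cases 1 and 3 she joins
the decomposition together with the bundle `S_t`; in Case 2 she replaces an agent whose value is not
above her share. Either way the count drops by exactly one (`LoopState.update`). Outside iteration
`t` the decomposition has as many agents as bundles, namely those preceding `S_t`. The for loop must
therefore stop before the bundles run out: there are `n` bundles but only `n - 1` agents besides the
divider (`forLoop_halts`).

An update costs little because breadth-first search moves one vertex out of the queue per round
(`search_halts`) and its paths are simple, so that moving agents along a path changes only the sizes
of its two ends (`IsPath.length_foldl_moved`). The inequality that defines an edge plays no role; it
matters only that a responsible agent belongs to the vertex where the edge starts.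

In the recursion the divider leaves and the remaining agents are partitioned among the calls. If the
work of one call, apart from its recursive calls, is charged to its divider, the total is at most
`n` times that work, up to constants (`solve_halts`). No good is lost: the divider's bundles exhaust
the goods (`makeBundles_halts`), every group in the decomposition is nonempty, and if nobody is left
outside then no bundle is left either. -/

/-- Started at any time, `c` halts after at most `b` steps with a result satisfying `P`. -/
def HaltsWithin {α : Type} (b : ℕ) (c : Comp α) (P : α → Prop) : Prop :=
  ∀ s, ∃ a s', c s = some (a, s') ∧ s' ≤ s + b ∧ P a

/-! ### Composition rules for time bounds -/

namespace HaltsWithin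

variable {α β : Type} {b b' : ℕ} {c d : Comp α} {f : α → Comp β} {P P' : α → Prop} {Q : β → Prop}

theorem ret {x : α} (h : P x) : HaltsWithin 0 (pure x) P :=
  fun s => ⟨x, s, rfl, le_rfl, h⟩

theorem bind (h : HaltsWithin b c P) (h' : ∀ a, P a → HaltsWithin b' (f a) Q) :
    HaltsWithin (b + b') (c >>= f) Q := by
  intro s
  obtain ⟨a, s', e, hs, ha⟩ := h s
  obtain ⟨y, s'', e', hs', hy⟩ := h' a ha s'
  refine ⟨y, s'', ?_, by omega, hy⟩
  change (c s).bind (fun r => f r.1 r.2) = _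
  rw [e]
  exact e'

theorem bindEq {x : α} (h : HaltsWithin b c (· = x)) (h' : HaltsWithin b' (f x) Q) :
    HaltsWithin (b + b') (c >>= f) Q :=
  h.bind fun _ ha => ha ▸ h'

theorem tick {f : Unit → Comp α} (h : HaltsWithin b (f ()) P) :
    HaltsWithin (b + 1) (tick >>= f) P := by
  intro s
  obtain ⟨a, s', e, hs, ha⟩ := h (s + 1)
  exact ⟨a, s', e, by omega, ha⟩

theorem mono (h : HaltsWithin b c P) (hb : b ≤ b') (hP : ∀ a, P a → P' a) :
    HaltsWithin b' c P' := by
  intro s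
  obtain ⟨a, s', e, hs, ha⟩ := h s
  exact ⟨a, s', e, by omega, hP a ha⟩

theorem le (h : HaltsWithin b c P) (hb : b ≤ b') : HaltsWithin b' c P :=
  h.mono hb fun _ => id

theorem imp (h : HaltsWithin b c P) (hP : ∀ a, P a → P' a) : HaltsWithin b c P' :=
  h.mono le_rfl hP

theorem ite {p : Prop} [Decidable p] (h : p → HaltsWithin b c P)
    (h' : ¬p → HaltsWithin b' d P) : HaltsWithin (max b b') (if p then c else d) P := by
  split
  · exact (h ‹_›).le (le_max_left _ _)
  · exact (h' ‹_›).le (le_max_right _ _)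

end HaltsWithin

/-! ### List operations -/

section Lists

variable {β : Type}

theorem len_halts (l : List β) : HaltsWithin (l.length + 1) (len l) (· = l.length) := by
  induction l with
  | nil => exact .tick (.ret rfl)
  | cons x l ih => exact .le (.tick (.bindEq ih (.ret rfl))) le_rfl

theorem append_halts (k l : List β) : HaltsWithin (k.length + 1) (append k l) (· = k ++ l) := by
  induction k with
  | nil => exact .tick (.ret rfl)
  | cons x k ih => exact .le (.tick (.bindEq ih (.ret rfl))) le_rfl

theorem concat_halts (L : List (List β)) :
    HaltsWithin (L.flatten.length + 2 * L.length + 1) (concat L) (· = L.flatten) := by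
  induction L with
  | nil => exact .tick (.ret rfl)
  | cons x L ih =>
    exact .le (.tick (.bindEq ih (append_halts x _)))
      (by simp only [List.flatten_cons, List.length_append, List.length_cons]; omega)

theorem select_halts {test : β → Comp Bool} {p : β → Bool} {b : ℕ} {l : List β}
    (h : ∀ x ∈ l, HaltsWithin b (test x) (· = p x)) :
    HaltsWithin (l.length * (b + 1) + 1) (select test l) (· = l.filter p) := by
  induction l with
  | nil => exact .le (.tick (.ret rfl)) (by simp)
  | cons x l ih =>
    refine .le (.tick (.bindEq (h x (by simp))
      (.bindEq (ih fun y hy => h y (by simp [hy])) (.ret ?_)))) ?_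
    · rw [List.filter_cons]
    · rw [List.length_cons, add_one_mul]; omega

theorem occurs_halts [DecidableEq β] (a : β) (l : List β) :
    HaltsWithin (l.length + 1) (occurs a l) (· = decide (a ∈ l)) := by
  induction l with
  | nil => exact .tick (.ret rfl)
  | cons x l ih =>
    refine .le (.tick (.ite (fun h => .ret ?_) fun h => ih.imp ?_))
      (by simp only [List.length_cons]; omega)
    · simp [h]
    · rintro _ rfl
      simp [h]

theorem remove_halts [DecidableEq β] (a : β) (l : List β) :
    HaltsWithin (l.length + 1) (remove a l) (· = l.erase a) := by
  induction l with
  | nil => exact .tick (.ret rfl)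
  | cons x l ih =>
    refine .le (.tick (.ite (fun h => .ret ?_) fun h => .bindEq ih (.ret ?_)))
      (by simp only [List.length_cons]; omega)
    · simp [h]
    · rw [List.erase_cons_tail (by simpa using Ne.symm h)]

theorem entry_halts (k : ℕ) (x : β) (l : List β) :
    HaltsWithin (l.length + 1) (entry k x l) (· ∈ x :: l) := by
  induction l generalizing k x with
  | nil =>
    cases k with
    | zero => exact .tick (.ret (by simp))
    | succ k => exact .tick (.ret (by simp))
  | cons y l ih =>
    cases k with
    | zero => exact .le (.tick (.ret (by simp))) (by simp)
    | succ k => exact .tick ((ih k y).imp fun a ha => List.mem_cons_of_mem _ ha)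

/-- Only membership of the chosen entry is recorded, so all later bounds hold uniformly in the rule
`pick`. -/
theorem choose_halts (pick : ℕ → ℕ) (x : β) (l : List β) :
    HaltsWithin (l.length + 1) (choose pick x l) (· ∈ x :: l) :=
  fun s => entry_halts (pick s) x l s

end Lists

/-! ### Values -/

section Values

variable {n m : ℕ} (v : Fin n → Fin m → ℝ)

/-- The value of a list of goods. -/
noncomputable def total (i : Fin n) (S : List (Fin m)) : ℝ := (S.map (v i)).sum

theorem value_halts (i : Fin n) (S : List (Fin m)) :
    HaltsWithin (S.length + 1) (value v i S) (· = total v i S) := by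
  induction S with
  | nil => exact .tick (.ret (by simp [total]))
  | cons j S ih => exact .le (.tick (.bindEq ih (.ret (by simp [total])))) le_rfl

theorem valueBundles_halts (i : Fin n) (A : List (List (Fin m))) :
    HaltsWithin (A.flatten.length + 2 * A.length + 1) (valueBundles v i A)
      (· = total v i A.flatten) := by
  induction A with
  | nil => exact .tick (.ret (by simp [total]))
  | cons S A ih =>
    exact .le (.tick (.bindEq (value_halts v i S) (.bindEq ih
      (.ret (by simp only [total, List.flatten_cons, List.map_append, List.sum_append])))))
      (by simp only [List.flatten_cons, List.length_append, List.length_cons]; omega)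

/-- A collection of at most `K` bundles with at most `K` goods in all. -/
def SmallBundles (K : ℕ) (A : List (List (Fin m))) : Prop :=
  A.flatten.length ≤ K ∧ A.length ≤ K

variable {v} {K N : ℕ} {M : List (Fin m)} {A : List (List (Fin m))}

theorem atLeastShare_halts (hM : M.length ≤ K) (hA : SmallBundles K A) (size : ℕ) (k : Fin n) :
    HaltsWithin (4 * K + 3) (atLeastShare v M N A size k)
      (· = decide (total v k M / (N : ℝ) ≤ total v k A.flatten / (size : ℝ))) :=
  .le (.tick (.bindEq (valueBundles_halts v k A) (.bindEq (value_halts v k M)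
    (.ret rfl)))) (by obtain ⟨h, h'⟩ := hA; omega)

theorem aboveShare_halts (hM : M.length ≤ K) (hA : SmallBundles K A) (size : ℕ) (k : Fin n) :
    HaltsWithin (4 * K + 3) (aboveShare v M N A size k)
      (· = decide (total v k M / (N : ℝ) < total v k A.flatten / (size : ℝ))) :=
  .le (.tick (.bindEq (valueBundles_halts v k A) (.bindEq (value_halts v k M)
    (.ret rfl)))) (by obtain ⟨h, h'⟩ := hA; omega)

theorem atMostShare_halts (hM : M.length ≤ K) (hA : SmallBundles K A) (size : ℕ) (k : Fin n) :
    HaltsWithin (4 * K + 3) (atMostShare v M N A size k)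
      (· = decide (total v k A.flatten / (size : ℝ) ≤ total v k M / (N : ℝ))) :=
  .le (.tick (.bindEq (valueBundles_halts v k A) (.bindEq (value_halts v k M)
    (.ret rfl)))) (by obtain ⟨h, h'⟩ := hA; omega)

end Values

/-! ### The divider's bundles -/

section Bundles

variable {n m : ℕ} (v : Fin n → Fin m → ℝ) (i : Fin n)

theorem insertGood_halts (g : Fin m) (l : List (Fin m)) :
    HaltsWithin (l.length + 1) (insertGood v i g l) (List.Perm (g :: l)) := by
  induction l with
  | nil => exact .tick (.ret (List.Perm.refl _))
  | cons h l ih =>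
    exact .le (.tick (.ite (fun _ => .ret (List.Perm.refl _))
      fun _ => .bind ih fun r hr => .ret ((List.Perm.swap h g l).trans (hr.cons h))))
      (by simp only [List.length_cons]; omega)

theorem sortGoods_halts (l : List (Fin m)) :
    HaltsWithin (l.length * (l.length + 2) + 1) (sortGoods v i l) (List.Perm l) := by
  induction l with
  | nil => exact .le (.tick (.ret (List.Perm.refl _))) (by simp)
  | cons g l ih =>
    refine .le (.tick (.bind (b' := l.length + 1) ih fun r hr =>
      (insertGood_halts v i g r).mono ?_ ?_)) ?_
    · rw [hr.length_eq]
    · exact fun a ha => (hr.cons g).trans ha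
    · rw [List.length_cons]; nlinarith

/-- With nonnegative values every partial sum is at most the total, so a bound that admits the whole
list never stops the scan early. This serves the last bundle, whose bound is the full remaining
value. -/
theorem takePrefix_halts (bound acc : ℝ) (l : List (Fin m)) :
    HaltsWithin (l.length + 1) (takePrefix v i bound acc l) (fun r => r.1 ++ r.2 = l ∧
      ((∀ j, 0 ≤ v i j) → acc + total v i l ≤ bound → r.2 = [])) := by
  induction l generalizing acc with
  | nil => exact .tick (.ret (by simp))
  | cons g l ih =>
    refine .le (.tick (.ite (fun _ => .bind (ih _) fun r hr => .ret ⟨by simp [hr.1], ?_⟩)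
      fun h => .ret ⟨rfl, fun h0 hb => (h ?_).elim⟩)) (by simp only [List.length_cons]; omega)
    · intro h0 hb
      refine hr.2 h0 ?_
      simpa [total, add_assoc] using hb
    · have : 0 ≤ total v i l := List.sum_nonneg (by simpa using fun j _ => h0 j)
      simp only [total, List.map_cons, List.sum_cons] at hb this
      linarith

/-- The last bundle takes everything that is left, since its bound is the remaining value divided by
one. This is what nonnegativity of the values is needed for. -/
theorem makeBundles_halts (h0 : ∀ j, 0 ≤ v i j) (k : ℕ) (l : List (Fin m)) :
    HaltsWithin (k * (2 * l.length + 3) + 1) (makeBundles v i k l) (fun B => B.length = k ∧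
      (0 < k → B.flatten = l)) := by
  induction k generalizing l with
  | zero => exact .le (.tick (.ret (by simp))) (by simp)
  | succ k ih =>
    refine .le (.tick (.bindEq (value_halts v i l) (.bind (takePrefix_halts v i _ 0 l)
      fun r hr => .bind (b := k * (2 * l.length + 3) + 1) ((ih r.2).le ?_)
        fun B hB => .ret ⟨?_, ?_⟩))) ?_
    · have : r.2.length ≤ l.length := by rw [← hr.1]; simp
      gcongr
    · simp [hB.1]
    · intro _
      rcases Nat.eq_zero_or_pos k with rfl | hk
      · have h2 := hr.2 h0 (by simp)
        have h3 := hr.1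
        rw [h2, List.append_nil] at h3
        have : B = [] := List.eq_nil_of_length_eq_zero hB.1
        simp [this, h3]
      · simp [hB.2 hk, hr.1]
    · nlinarith

end Bundles

/-! ### Decompositions -/

section Decompositions

variable {n m : ℕ}

/-- The participants of a decomposition. -/
def agentsIn (D : List (Subproblem n m)) : List (Fin n) := D.flatMap (·.agents)

/-- The bundles of a decomposition. -/
def bundlesIn (D : List (Subproblem n m)) : List (List (Fin m)) := D.flatMap (·.bundles)

theorem agentsOf_halts (D : List (Subproblem n m)) :
    HaltsWithin ((agentsIn D).length + 2 * D.length + 1) (agentsOf D) (· = agentsIn D) := by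
  induction D with
  | nil => exact .tick (.ret rfl)
  | cons P D ih =>
    exact .le (.tick (.bindEq ih ((append_halts P.agents _))))
      (by simp only [agentsIn, List.flatMap_cons, List.length_append, List.length_cons]; omega)

theorem nonParticipants_halts (others : List (Fin n)) (D : List (Subproblem n m)) :
    HaltsWithin ((agentsIn D).length + 2 * D.length + 3 +
        others.length * ((agentsIn D).length + 2))
      (nonParticipants others D) (· = others.filter (fun k => !decide (k ∈ agentsIn D))) :=
  .le (.tick (.bindEq (agentsOf_halts D)
    (select_halts (b := (agentsIn D).length + 1) fun k _ =>
      .le (.bindEq (occurs_halts k _) (.ret rfl)) le_rfl))) (by ring_nf; omega)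

/-- This is why nonemptiness of the groups is carried along as an invariant: it bounds the size of
the sub-problem graph. -/
theorem length_le_length_agentsIn {D : List (Subproblem n m)} (hD : ∀ P ∈ D, P.agents ≠ []) :
    D.length ≤ (agentsIn D).length := by
  induction D with
  | nil => simp
  | cons P D ih =>
    have h1 := ih fun Q hQ => hD Q (by simp [hQ])
    have h2 := List.length_pos_iff.2 (hD P (by simp))
    simp only [agentsIn, List.flatMap_cons, List.length_append, List.length_cons] at *
    omega

end Decompositions

/-! ### The vertices of the sub-problem graph -/

section Vertices

variable {n m : ℕ}

/-- The numbering of a decomposition from `k` on. -/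
def numbered : ℕ → List (Subproblem n m) → List (Vertex n m)
  | _, [] => []
  | k, P :: D => ⟨k, P.bundles, P.agents⟩ :: numbered (k + 1) D

/-- A vertex as a sub-problem. -/
def Vertex.toSubproblem (w : Vertex n m) : Subproblem n m := ⟨w.bundles, w.agents⟩

theorem number_halts (k : ℕ) (D : List (Subproblem n m)) :
    HaltsWithin (D.length + 1) (number k D) (· = numbered k D) := by
  induction D generalizing k with
  | nil => exact .tick (.ret rfl)
  | cons P D ih => exact .le (.tick (.bindEq (ih _) (.ret rfl))) le_rfl

theorem map_toSubproblem_numbered (k : ℕ) (D : List (Subproblem n m)) :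
    (numbered k D).map Vertex.toSubproblem = D := by
  induction D generalizing k with
  | nil => rfl
  | cons P D ih => simp [numbered, ih, Vertex.toSubproblem]

theorem map_id_numbered (k : ℕ) (D : List (Subproblem n m)) :
    (numbered k D).map Vertex.id = List.range' k D.length := by
  induction D generalizing k with
  | nil => rfl
  | cons P D ih => simp [numbered, ih, List.range'_succ]

theorem le_id_of_mem_numbered {k : ℕ} {D : List (Subproblem n m)} {w : Vertex n m}
    (hw : w ∈ numbered k D) : k ≤ w.id := by
  have : w.id ∈ (numbered k D).map Vertex.id := List.mem_map_of_mem hw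
  rw [map_id_numbered, List.mem_range'_1] at this
  exact this.1

theorem flatMap_agents_eq (V : List (Vertex n m)) :
    V.flatMap (·.agents) = agentsIn (V.map Vertex.toSubproblem) := by
  simp [agentsIn, List.flatMap_map, Vertex.toSubproblem]

theorem flatMap_bundles_eq (V : List (Vertex n m)) :
    V.flatMap (·.bundles) = bundlesIn (V.map Vertex.toSubproblem) := by
  simp [bundlesIn, List.flatMap_map, Vertex.toSubproblem]

theorem flatMap_agents_numbered (k : ℕ) (D : List (Subproblem n m)) :
    (numbered k D).flatMap (·.agents) = agentsIn D := by
  rw [flatMap_agents_eq, map_toSubproblem_numbered]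

theorem flatMap_bundles_numbered (k : ℕ) (D : List (Subproblem n m)) :
    (numbered k D).flatMap (·.bundles) = bundlesIn D := by
  rw [flatMap_bundles_eq, map_toSubproblem_numbered]

theorem subproblemsFrom_halts (k : ℕ) (V : List (Vertex n m)) :
    HaltsWithin (V.length + 1) (subproblemsFrom k V)
      (· = (V.filter (k ≤ ·.id)).map Vertex.toSubproblem) := by
  induction V with
  | nil => exact .tick (.ret rfl)
  | cons w V ih =>
    refine .le (.tick (.bindEq ih (.ret ?_))) le_rfl
    by_cases h : k ≤ w.id <;> simp [h, Vertex.toSubproblem]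

/-- A vertex with at most `K` agents and at most `K` bundles, with at most `K` goods in all. -/
def Vertex.Small (K : ℕ) (w : Vertex n m) : Prop :=
  w.agents.length ≤ K ∧ SmallBundles K w.bundles

end Vertices

/-! ### Paths and moves -/

section Moves

variable {n m : ℕ}

/-- `p` is the list of moves, from the last one to the first one, along a simple path from the
vertex numbered `0` to the vertex numbered `w`; the numbers of all vertices are `ids`, and `g` gives
the agents of each vertex. -/
inductive IsPath (ids : List ℕ) (g : ℕ → List (Fin n)) : List (Move n) → ℕ → Prop
  | nil : IsPath ids g [] 0
  | cons {p : List (Move n)} {b : Fin n} {u w : ℕ} : IsPath ids g p u → b ∈ g u → u ∈ ids →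
      w ∈ ids → u ≠ w → (∀ e ∈ p, e.source ≠ w ∧ e.target ≠ w) →
      IsPath ids g (⟨b, u, w⟩ :: p) w

/-- The agents of each vertex after a move. -/
def moved (g : ℕ → List (Fin n)) (e : Move n) : ℕ → List (Fin n) := fun i =>
  let out := if i = e.source then (g i).erase e.agent else g i
  if i = e.target then e.agent :: out else out

variable {ids : List ℕ} {g g' : ℕ → List (Fin n)} {p : List (Move n)} {w : ℕ}

/-- Being a path depends on the agents of the source vertices alone. -/
theorem IsPath.congr (h : IsPath ids g p w) (hg : ∀ e ∈ p, g' e.source = g e.source) :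
    IsPath ids g' p w := by
  induction h with
  | nil => exact .nil
  | cons h hb hu hw huw hp ih =>
    have := hg _ List.mem_cons_self
    exact .cons (ih fun e he => hg e (by simp [he])) (by simpa [this] using hb) hu hw huw hp

theorem IsPath.source_ne (h : IsPath ids g p w) : ∀ e ∈ p, e.source ≠ w := by
  cases h with
  | nil => simp
  | cons h hb hu hw huw hp =>
    intro e he
    rcases List.mem_cons.1 he with rfl | he
    · exact huw
    · exact (hp e he).1

theorem moved_of_ne {e : Move n} {i : ℕ} (h : i ≠ e.source) (h' : i ≠ e.target) :
    moved g e i = g i := by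
  simp [moved, h, h']

theorem foldl_moved_of_ne {i : ℕ} (h : ∀ e ∈ p, e.source ≠ i ∧ e.target ≠ i) :
    p.foldl moved g i = g i := by
  induction p generalizing g with
  | nil => rfl
  | cons e p ih =>
    rw [List.foldl_cons, ih fun e' he => h e' (by simp [he]),
      moved_of_ne (h e (by simp)).1.symm (h e (by simp)).2.symm]

/-- Moves are performed from the far end backwards. The last edge alters only `u` and `w`, and by
simplicity neither is a source of an earlier edge, so the responsible agents of the remaining edges
are still in place. -/
theorem IsPath.tail {b : Fin n} {u : ℕ} (h : IsPath ids g p u) (hp : ∀ e ∈ p, e.source ≠ w) :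
    IsPath ids (moved g ⟨b, u, w⟩) p u :=
  h.congr fun e he => moved_of_ne (h.source_ne e he) (hp e he)

theorem length_moved {b : Fin n} {u : ℕ} (hb : b ∈ g u) (huw : u ≠ w) (i : ℕ) :
    (moved g ⟨b, u, w⟩ i).length + (if i = u then 1 else 0) =
      (g i).length + (if i = w then 1 else 0) := by
  by_cases hu : i = u
  · subst hu
    have := List.length_erase_add_one hb
    simp [moved, huw, this]
  · by_cases hw : i = w
    · subst hw
      simp [moved, hu]
    · simp [moved, hu, hw]

/-- The changes telescope: each inner vertex loses one agent and gains one. The indicators are added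
on both sides to avoid subtraction. -/
theorem IsPath.length_foldl_moved (h : IsPath ids g p w) (i : ℕ) :
    (p.foldl moved g i).length + (if i = 0 then 1 else 0) =
      (g i).length + (if i = w then 1 else 0) := by
  induction p generalizing g w with
  | nil => cases h; rfl
  | cons e p ih =>
    cases h with
    | @cons _ b _ _ h hb hu hw huw hp =>
      have h1 := ih (h.tail (b := b) fun e he => (hp e he).1)
      have h2 := length_moved hb huw i
      rw [List.foldl_cons]
      omega

/-- On a simple path only the final edge touches the endpoint, and it adds an agent. Hence the agent
`i'` of Case 2 is still there to be removed. -/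
theorem IsPath.subset_foldl_moved (h : IsPath ids g p w) : g w ⊆ p.foldl moved g w := by
  cases h with
  | nil => simp
  | cons h hb hu hw huw hp =>
    rw [List.foldl_cons, foldl_moved_of_ne hp]
    simp [moved, huw.symm]

theorem perm_flatMap_moved {b : Fin n} {u : ℕ} (hids : ids.Nodup) (hb : b ∈ g u) (hu : u ∈ ids)
    (hw : w ∈ ids) (huw : u ≠ w) : (ids.flatMap (moved g ⟨b, u, w⟩)).Perm (ids.flatMap g) := by
  have hw' : w ∈ ids.erase u := (List.mem_erase_of_ne huw.symm).2 hw
  have h1 : ids.Perm (u :: w :: (ids.erase u).erase w) :=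
    (List.perm_cons_erase hu).trans ((List.perm_cons_erase hw').cons u)
  have h2 : ((ids.erase u).erase w).flatMap (moved g ⟨b, u, w⟩) =
      ((ids.erase u).erase w).flatMap g := by
    have hnd := h1.nodup_iff.1 hids
    simp only [List.nodup_cons, List.mem_cons, not_or] at hnd
    refine List.flatMap_congr fun i hi => moved_of_ne ?_ ?_
    · rintro rfl; exact hnd.1.2 hi
    · rintro rfl; exact hnd.2.1 hi
  refine (h1.flatMap_right _).trans (List.Perm.trans ?_ (h1.flatMap_right _).symm)
  rw [List.flatMap_cons, List.flatMap_cons, List.flatMap_cons, List.flatMap_cons, h2,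
    ← List.append_assoc, ← List.append_assoc]
  refine List.Perm.append_right _ ?_
  have : (b :: (g u).erase b).Perm (g u) := (List.perm_cons_erase hb).symm
  simp only [moved, huw, huw.symm, if_true, if_false]
  exact List.perm_middle.trans (this.append_right _)

theorem IsPath.perm_flatMap (hids : ids.Nodup) (h : IsPath ids g p w) :
    (ids.flatMap (p.foldl moved g)).Perm (ids.flatMap g) := by
  induction p generalizing g w with
  | nil => rfl
  | cons e p ih =>
    cases h with
    | cons h hb hu hw huw hp =>
      exact (ih (h.tail fun e he => (hp e he).1)).trans (perm_flatMap_moved hids hb hu hw huw)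

/-- Replace the agents of a vertex by those given by `g`. -/
def Vertex.relabel (g : ℕ → List (Fin n)) (w : Vertex n m) : Vertex n m := ⟨w.id, w.bundles, g w.id⟩

/-- Ids and bundles never change under a move, so a vertex list is kept as a fixed list relabelled
by a function from ids to agents, and moves act on that function. -/
theorem applyMove_halts {K : ℕ} (e : Move n) (hK : (g e.source).length ≤ K)
    (V : List (Vertex n m)) :
    HaltsWithin (V.length * (K + 2) + 1) (applyMove e (V.map (Vertex.relabel g)))
      (· = V.map (Vertex.relabel (moved g e))) := by
  induction V with
  | nil => exact .le (.tick (.ret rfl)) (by simp)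
  | cons w V ih =>
    refine .le (.tick (.bindEq ih (.ite (b := K + 1 + 0)
      (fun h => .bindEq (.le (remove_halts e.agent (g w.id)) ?_) (.ret ?_))
      fun h => .bindEq (x := g w.id) (.ret rfl) (.ret ?_)))) ?_
    · rw [show w.id = e.source from h]; omega
    · simp [Vertex.relabel, moved, show w.id = e.source from h]
    · simp [Vertex.relabel, moved, show ¬w.id = e.source from h]
      rfl
    · rw [List.length_cons, add_one_mul]; omega

theorem applyMoves_halts {K : ℕ} (h : IsPath ids g p w)
    (hK : ∀ e ∈ p, (g e.source).length ≤ K) (V : List (Vertex n m)) :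
    HaltsWithin (p.length * (V.length * (K + 2) + 2) + 1) (applyMoves p (V.map (Vertex.relabel g)))
      (· = V.map (Vertex.relabel (p.foldl moved g))) := by
  induction p generalizing g w with
  | nil => exact .le (.tick (.ret rfl)) (by simp)
  | cons e p ih =>
    cases h with
    | cons h hb hu hw huw hp =>
      refine .le (.tick (.bindEq (applyMove_halts _ (hK _ (by simp)) V)
        (ih (h.tail fun e he => (hp e he).1) fun e he => ?_))) ?_
      · rw [moved_of_ne (h.source_ne e he) (hp e he).1]
        exact hK e (by simp [he])
      · rw [List.length_cons, add_one_mul]; omega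

theorem dropAgent_halts {K : ℕ} (a : Fin n) (k : ℕ) (hK : (g k).length ≤ K)
    (V : List (Vertex n m)) :
    HaltsWithin (V.length * (K + 2) + 1) (dropAgent a k (V.map (Vertex.relabel g)))
      (· = V.map (Vertex.relabel fun i => if i = k then (g i).erase a else g i)) := by
  induction V with
  | nil => exact .le (.tick (.ret rfl)) (by simp)
  | cons w V ih =>
    refine .le (.tick (.bindEq ih (.ite (b := K + 1 + 0)
      (fun h => .bindEq (.le (remove_halts a (g w.id)) ?_) (.ret ?_))
      fun h => .bindEq (x := g w.id) (.ret rfl) (.ret ?_)))) ?_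
    · rw [show w.id = k from h]; omega
    · simp_all [Vertex.relabel]
    · simp_all [Vertex.relabel]
    · rw [List.length_cons, add_one_mul]; omega

end Moves

/-! ### Breadth-first search -/

section Search

variable {n m : ℕ} {v : Fin n → Fin m → ℝ} {pick : ℕ → ℕ} {M : List (Fin m)} {N K : ℕ}

theorem edgeAgents_halts (hM : M.length ≤ K) {u w : Vertex n m} (hu : u.agents.length ≤ K)
    (hw : w.Small K) :
    HaltsWithin (K * (4 * K + 4) + K + 3) (edgeAgents v M N u w) (List.Sublist · u.agents) :=
  .le (.tick (.ite (fun _ => .ret (List.nil_sublist _))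
    fun _ => .bindEq (len_halts w.agents) (HaltsWithin.imp (b := K * (4 * K + 4) + 1)
      (HaltsWithin.le (select_halts fun k _ => atLeastShare_halts hM hw.2 _ k) (by gcongr))
      (by rintro _ rfl; exact List.filter_sublist)))) (by have := hw.1; omega)

theorem expand_halts (hM : M.length ≤ K) (x : Reached n m) (hx : x.vertex.agents.length ≤ K)
    {l : List (Vertex n m)} (hl : ∀ w ∈ l, w.Small K) :
    HaltsWithin (l.length * (K * (4 * K + 4) + 2 * K + 6) + 1) (expand v pick M N x l) (fun r =>
      (r.1.map Reached.vertex ++ r.2).Perm l ∧ r.2.Sublist l ∧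
        ∀ y ∈ r.1, ∃ b ∈ x.vertex.agents, y.path = ⟨b, x.vertex.id, y.vertex.id⟩ :: x.path) := by
  induction l with
  | nil => exact .le (.tick (.ret (by simp))) (by simp)
  | cons w l ih =>
    refine .le (.tick (.bind (edgeAgents_halts hM hx (hl w (by simp))) fun E hE =>
      .bind (b' := K + 1) (ih fun y hy => hl y (by simp [hy])) fun r hr => ?_)) ?_
    · cases E with
      | nil =>
        refine .le (.ret ⟨?_, hr.2.1.cons_cons w, hr.2.2⟩) (Nat.zero_le _)
        exact List.perm_middle.trans (hr.1.cons w)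
      | cons a E =>
        refine .le (.bind (choose_halts pick a E) fun b hb =>
          .ret ⟨hr.1.cons w, hr.2.1.cons w, ?_⟩) ?_
        · intro y hy
          rcases List.mem_cons.1 hy with rfl | hy
          · exact ⟨b, hE.subset hb, rfl⟩
          · exact hr.2.2 y hy
        · have := hE.length_le
          simp only [List.length_cons] at this
          omega
    · rw [List.length_cons, add_one_mul]; omega

/-- The state of the search: the vertices `V` are those reached and those unseen; the agents of
each vertex are given by `g`, and each reached vertex comes with a simple path to it through
reached vertices. -/
structure SearchState (V : List (Vertex n m)) (g : ℕ → List (Fin n)) (reached : List (Reached n m))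
    (unseen : List (Vertex n m)) : Prop where
  perm : (reached.map Reached.vertex ++ unseen).Perm V
  isPath : ∀ x ∈ reached, IsPath (V.map Vertex.id) g x.path x.vertex.id
  avoids : ∀ x ∈ reached, ∀ e ∈ x.path, ∀ w ∈ unseen, e.source ≠ w.id ∧ e.target ≠ w.id
  length_le : ∀ x ∈ reached, x.path.length + unseen.length ≤ V.length

/-- A newly found vertex was unseen, so the path to `x` avoids it and the extended path stays
simple. Lengthening a path by one uses up at least one unseen vertex, which keeps path lengths
bounded by the number of vertices. -/
theorem SearchState.expand {V : List (Vertex n m)} {g : ℕ → List (Fin n)}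
    {reached new : List (Reached n m)} {unseen rest : List (Vertex n m)}
    (hV : (V.map Vertex.id).Nodup) (hg : ∀ w ∈ V, g w.id = w.agents)
    (h : SearchState V g reached unseen) {x : Reached n m} (hx : x ∈ reached)
    (hperm : (new.map Reached.vertex ++ rest).Perm unseen)
    (hnew : ∀ y ∈ new, ∃ b ∈ x.vertex.agents,
      y.path = ⟨b, x.vertex.id, y.vertex.id⟩ :: x.path) :
    SearchState V g (reached ++ new) rest := by
  have hsub : ∀ w ∈ rest, w ∈ unseen := fun w hw => hperm.subset (by simp [hw])
  have hVn := (h.perm.map Vertex.id).nodup_iff.2 hV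
  have hun := (hperm.map Vertex.id).nodup_iff.2
    (by rw [List.map_append] at hVn; exact hVn.of_append_right)
  have hxV : x.vertex ∈ V := h.perm.subset
    (List.mem_append_left _ (List.mem_map_of_mem hx))
  have hxu : ∀ w ∈ unseen, x.vertex.id ≠ w.id := by
    intro w hw he
    rw [List.map_append, List.nodup_append] at hVn
    exact hVn.2.2 _ (List.mem_map_of_mem (List.mem_map_of_mem hx)) _ (List.mem_map_of_mem hw) he
  have hyu : ∀ y ∈ new, y.vertex ∈ unseen := fun y hy =>
    hperm.subset (List.mem_append_left _ (List.mem_map_of_mem hy))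
  have hyr : ∀ y ∈ new, ∀ w ∈ rest, y.vertex.id ≠ w.id := by
    intro y hy w hw he
    rw [List.map_append, List.nodup_append] at hun
    exact hun.2.2 _ (List.mem_map_of_mem (List.mem_map_of_mem hy)) _ (List.mem_map_of_mem hw) he
  have hlen : new.length + rest.length = unseen.length := by simpa using hperm.length_eq
  refine ⟨?_, ?_, ?_, ?_⟩
  · rw [List.map_append, List.append_assoc]
    exact (hperm.append_left _).trans h.perm
  · intro y hy
    rcases List.mem_append.1 hy with hy | hy
    · exact h.isPath y hy
    · obtain ⟨b, hb, hp⟩ := hnew y hy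
      rw [hp]
      refine .cons (h.isPath x hx) (by rwa [hg _ hxV]) (List.mem_map_of_mem hxV)
        (List.mem_map_of_mem ?_) (hxu _ (hyu y hy)) fun e he => h.avoids x hx e he _ (hyu y hy)
      exact h.perm.subset (List.mem_append_right _ (hyu y hy))
  · intro y hy e he w hw
    rcases List.mem_append.1 hy with hy | hy
    · exact h.avoids y hy e he w (hsub w hw)
    · obtain ⟨b, hb, hp⟩ := hnew y hy
      rw [hp] at he
      rcases List.mem_cons.1 he with rfl | he
      · exact ⟨hxu w (hsub w hw), hyr y hy w hw⟩
      · exact h.avoids x hx e he w (hsub w hw)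
  · intro y hy
    rcases List.mem_append.1 hy with hy | hy
    · have := h.length_le y hy
      omega
    · obtain ⟨b, hb, hp⟩ := hnew y hy
      have := h.length_le x hx
      have := List.length_pos_of_mem hy
      rw [hp, List.length_cons]
      omega

theorem SearchState.of_perm {V : List (Vertex n m)} {g : ℕ → List (Fin n)}
    {reached reached' : List (Reached n m)} {unseen : List (Vertex n m)}
    (h : SearchState V g reached unseen) (hr : reached.Perm reached') :
    SearchState V g reached' unseen :=
  ⟨((hr.symm.map _).append_right _).trans h.perm, fun x hx => h.isPath x (hr.symm.subset hx),
    fun x hx => h.avoids x (hr.symm.subset hx), fun x hx => h.length_le x (hr.symm.subset hx)⟩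

/-- Queue and unseen vertices together shrink by one per round: discovered vertices pass from the
second to the first, and the head of the queue is done with. That the final unseen vertices were
unseen at the start shows later that `w_α` is reached. -/
theorem search_halts (hM : M.length ≤ K) {V : List (Vertex n m)} {g : ℕ → List (Fin n)}
    (hV : (V.map Vertex.id).Nodup) (hg : ∀ w ∈ V, g w.id = w.agents) (hK : ∀ w ∈ V, w.Small K)
    {T : ℕ} (hT : V.length ≤ T) {fuel : ℕ} {queue done : List (Reached n m)}
    {unseen : List (Vertex n m)} (hfuel : queue.length + unseen.length < fuel)
    (h : SearchState V g (queue ++ done) unseen) :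
    HaltsWithin ((queue.length + unseen.length) *
        (T * (K * (4 * K + 4) + 2 * K + 6) + T + 3) + 1)
      (search v pick M N fuel queue unseen done)
      (fun R => SearchState V g R.1 R.2 ∧ R.2 ⊆ unseen) := by
  induction fuel generalizing queue done unseen with
  | zero => omega
  | succ fuel ih =>
    cases queue with
    | nil => exact .le (.tick (.ret ⟨h, List.Subset.refl _⟩)) (by omega)
    | cons x queue =>
      have hl : queue.length + done.length + 1 + unseen.length = V.length := by
        have := h.perm.length_eq
        simp only [List.cons_append, List.map_cons, List.map_append, List.length_cons,
          List.length_append, List.length_map] at this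
        omega
      have hxV : x.vertex ∈ V := h.perm.subset (by simp)
      have hu : ∀ w ∈ unseen, w ∈ V := fun w hw => h.perm.subset (by simp [hw])
      refine .le (.tick (.bind (expand_halts hM x (hK _ hxV).1 fun w hw => hK w (hu w hw))
        (b' := queue.length + 1 + ((queue.length + unseen.length) *
          (T * (K * (4 * K + 4) + 2 * K + 6) + T + 3) + 1))
        fun r hr => .bindEq (append_halts queue r.1) ?_)) ?_
      · have hlen : r.1.length + r.2.length = unseen.length := by simpa using hr.1.length_eq
        simp only [List.length_cons] at hfuel
        have hs : SearchState V g ((queue ++ r.1) ++ x :: done) r.2 :=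
          (h.expand hV hg (x := x) (by simp) hr.1 hr.2.2).of_perm (by
            classical
            refine List.perm_iff_count.2 fun a => ?_
            simp only [List.cons_append, List.count_append, List.count_cons]
            omega)
        refine (ih (by simp only [List.length_append]; omega) hs).mono ?_ ?_
        · rw [List.length_append, add_assoc, hlen]
        · exact fun R hR => ⟨hR.1, List.Subset.trans hR.2 hr.2.1.subset⟩
      · have : unseen.length * (K * (4 * K + 4) + 2 * K + 6) ≤
          T * (K * (4 * K + 4) + 2 * K + 6) := by gcongr; omega
        have hadd : (x :: queue).length + unseen.length = queue.length + unseen.length + 1 := by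
          simp only [List.length_cons]; omega
        rw [hadd, add_one_mul]
        omega

end Search

/-! ### The update of a decomposition -/

section Update

variable {n m : ℕ} {v : Fin n → Fin m → ℝ} {pick : ℕ → ℕ} {M : List (Fin m)} {N K : ℕ}
  {A : List (List (Fin m))} {t : ℕ} {S : List (Fin m)} {k : Fin n} {D D' : List (Subproblem n m)}

theorem reachedBeta_halts (R : List (Reached n m)) :
    HaltsWithin (R.length * 2 + 1) (reachedBeta R) (· = R.filter (·.vertex.id = 1)) :=
  select_halts (b := 1) fun _ _ => .tick (.ret rfl)

theorem pairWith_halts (x : Reached n m) (l : List (Fin n)) :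
    HaltsWithin (l.length + 1) (pairWith x l) (· = l.map (·, x)) := by
  induction l with
  | nil => exact .tick (.ret rfl)
  | cons a l ih => exact .le (.tick (.bindEq ih (.ret rfl))) le_rfl

theorem mergeReached_halts {R : List (Reached n m)} (hR : ∀ x ∈ R, x.vertex.Small K) :
    HaltsWithin (R.length * (2 * K + 3) + 1) (mergeReached R)
      (· = ⟨(R.map Reached.vertex).flatMap (·.bundles),
        (R.map Reached.vertex).flatMap (·.agents)⟩) := by
  induction R with
  | nil => exact .le (.tick (.ret rfl)) (by simp)
  | cons x R ih =>
    refine .le (.tick (.bindEq (ih fun y hy => hR y (by simp [hy]))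
      (.bindEq (append_halts _ _) (.bindEq (append_halts _ _) (.ret rfl))))) ?_
    have h1 := (hR x (by simp)).1
    have h2 := (hR x (by simp)).2.2
    rw [List.length_cons, add_one_mul]
    omega

variable (v M N A t) in
/-- The value of `A` for `a`, divided by `t`, is at most the share of `a`. -/
def Low (a : Fin n) : Prop :=
  total v a A.flatten / (t : ℝ) ≤ total v a M / (N : ℝ)

theorem lowAgents_halts (hM : M.length ≤ K) (hA : SmallBundles K A) {R : List (Reached n m)}
    (hR : ∀ x ∈ R, x.vertex.Small K) :
    HaltsWithin (R.length * (K * (4 * K + 4) + 2 * K + 4) + 1) (lowAgents v M N A t R) (fun L =>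
      L.length ≤ R.length * K ∧
        ∀ y ∈ L, y.2 ∈ R ∧ y.1 ∈ y.2.vertex.agents ∧ Low v M N A t y.1) := by
  induction R with
  | nil => exact .le (.tick (.ret (by simp))) (by simp)
  | cons x R ih =>
    have hx := (hR x (by simp)).1
    refine .le (.tick (.bind (b := K * (4 * K + 4) + 1)
      (P := fun a => a.length ≤ K ∧ ∀ i ∈ a, i ∈ x.vertex.agents ∧ Low v M N A t i)
      (HaltsWithin.mono (select_halts fun a _ => atMostShare_halts hM hA t a) (by gcongr) ?_)
      fun a ha => .bindEq (.le (pairWith_halts x a) (b' := K + 1) (by have := ha.1; omega))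
      (.bind (ih fun y hy => hR y (by simp [hy])) fun L hL =>
        HaltsWithin.mono (b' := K + 1) (append_halts _ _) ?_ ?_))) ?_
    · rintro _ rfl
      refine ⟨(List.length_filter_le _ _).trans hx, fun i hi => ?_⟩
      simpa [Low] using hi
    · rw [List.length_map]
      have := ha.1
      omega
    · rintro _ rfl
      constructor
      · rw [List.length_append, List.length_map, List.length_cons, add_one_mul]
        have := ha.1
        have := hL.1
        omega
      · intro y hy
        rcases List.mem_append.1 hy with hy | hy
        · obtain ⟨i, hi, rfl⟩ := List.mem_map.1 hy
          exact ⟨by simp, ha.2 i hi⟩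
        · exact ⟨List.mem_cons_of_mem _ (hL.2 y hy).1, (hL.2 y hy).2⟩
    · rw [List.length_cons, add_one_mul]
      omega

variable (v M N A t S k D D') in
/-- The possible effects on a decomposition of an update with agent `k` and bundle `S`: either `k`
and `S` join, or `k` replaces an agent whose value for `A` is low. -/
def IsUpdate : Prop :=
  (∀ P ∈ D', P.agents ≠ []) ∧
    ((agentsIn D').Perm (k :: agentsIn D) ∧ (bundlesIn D').Perm (S :: bundlesIn D) ∨
      ∃ a, Low v M N A t a ∧ (a :: agentsIn D').Perm (k :: agentsIn D) ∧
        (bundlesIn D').Perm (bundlesIn D))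

/-- The vertices of the sub-problem graph. -/
def vertices (k : Fin n) (S : List (Fin m)) (D : List (Subproblem n m)) : List (Vertex n m) :=
  ⟨0, [], [k]⟩ :: ⟨1, [S], []⟩ :: numbered 2 D

theorem map_id_vertices :
    (vertices k S D).map Vertex.id = 0 :: 1 :: List.range' 2 D.length := by
  simp [vertices, map_id_numbered]

theorem nodup_map_id_vertices : ((vertices k S D).map Vertex.id).Nodup := by
  rw [map_id_vertices, show 0 :: 1 :: List.range' 2 D.length = List.range' 0 (D.length + 2) by
    simp [List.range'_succ]]
  exact List.nodup_range'

/-- Distinct ids make the agents of a vertex a function of its id. -/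
theorem exists_agents_vertices {V : List (Vertex n m)} (hV : (V.map Vertex.id).Nodup) :
    ∃ g : ℕ → List (Fin n), ∀ w ∈ V, g w.id = w.agents := by
  classical
  refine ⟨fun i => if h : ∃ w ∈ V, w.id = i then h.choose.agents else [], fun w hw => ?_⟩
  have h : ∃ u ∈ V, u.id = w.id := ⟨w, hw, rfl⟩
  simp only [dif_pos h]
  rw [List.inj_on_of_nodup_map hV h.choose_spec.1 hw h.choose_spec.2]

/-- The decomposition `D` with the agents of its sub-problems, numbered from `2` on, given by `f`. -/
def relabeled (D : List (Subproblem n m)) (f : ℕ → List (Fin n)) : List (Subproblem n m) :=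
  ((numbered 2 D).map (Vertex.relabel f)).map Vertex.toSubproblem

theorem agentsIn_relabeled (f : ℕ → List (Fin n)) :
    agentsIn (relabeled D f) = (List.range' 2 D.length).flatMap f := by
  rw [← map_id_numbered]
  simp [agentsIn, relabeled, List.flatMap_map, Vertex.toSubproblem, Vertex.relabel]

theorem bundlesIn_relabeled (f : ℕ → List (Fin n)) :
    bundlesIn (relabeled D f) = bundlesIn D := by
  rw [← flatMap_bundles_numbered 2 D]
  simp [bundlesIn, relabeled, List.flatMap_map, Vertex.toSubproblem, Vertex.relabel]

theorem subproblemsFrom_one_halts (f : ℕ → List (Fin n)) :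
    HaltsWithin (D.length + 3) (subproblemsFrom 1 ((vertices k S D).map (Vertex.relabel f)))
      (· = ⟨[S], f 1⟩ :: relabeled D f) := by
  refine (subproblemsFrom_halts 1 _).mono ?_ ?_
  · have := congrArg List.length (map_toSubproblem_numbered 2 D)
    simp only [List.length_map, vertices, List.length_cons] at *
    omega
  · rintro _ rfl
    have : ((numbered 2 D).map (Vertex.relabel f)).filter (1 ≤ ·.id) =
        (numbered 2 D).map (Vertex.relabel f) := by
      refine List.filter_eq_self.2 fun w hw => ?_
      obtain ⟨u, hu, rfl⟩ := List.mem_map.1 hw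
      have := le_id_of_mem_numbered hu
      exact decide_eq_true (show 1 ≤ u.id by omega)
    rw [relabeled, ← this]
    simp [vertices, Vertex.relabel, Vertex.toSubproblem]

theorem subproblemsFrom_two_halts (f : ℕ → List (Fin n)) :
    HaltsWithin (D.length + 3) (subproblemsFrom 2 ((vertices k S D).map (Vertex.relabel f)))
      (· = relabeled D f) := by
  refine (subproblemsFrom_halts 2 _).mono ?_ ?_
  · have := congrArg List.length (map_toSubproblem_numbered 2 D)
    simp only [List.length_map, vertices, List.length_cons] at *
    omega
  · rintro _ rfl
    have : ((numbered 2 D).map (Vertex.relabel f)).filter (2 ≤ ·.id) =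
        (numbered 2 D).map (Vertex.relabel f) := by
      refine List.filter_eq_self.2 fun w hw => ?_
      obtain ⟨u, hu, rfl⟩ := List.mem_map.1 hw
      have := le_id_of_mem_numbered hu
      exact decide_eq_true (show 2 ≤ u.id by omega)
    rw [relabeled, ← this]
    simp [vertices, Vertex.relabel]

/-! ### The three cases of an update -/

section Effects

variable {g : ℕ → List (Fin n)} {p : List (Move n)} {w : ℕ} {f : ℕ → List (Fin n)}

theorem relabeled_agents_ne_nil (hD : ∀ P ∈ D, P.agents ≠ [])
    (hg : ∀ w ∈ vertices k S D, g w.id = w.agents)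
    (hf : ∀ i, 2 ≤ i → (f i).length = (g i).length) : ∀ P ∈ relabeled D f, P.agents ≠ [] := by
  intro P hP
  obtain ⟨w, hw, rfl⟩ := List.mem_map.1 hP
  obtain ⟨u, hu, rfl⟩ := List.mem_map.1 hw
  have h1 := hf u.id (le_id_of_mem_numbered hu)
  rw [hg u (by simp [vertices, hu])] at h1
  have h2 : u.toSubproblem ∈ D := by
    have := List.mem_map_of_mem (f := Vertex.toSubproblem) hu
    rwa [map_toSubproblem_numbered] at this
  have h3 := List.length_pos_iff.2 (hD _ h2)
  simp only [Vertex.toSubproblem, Vertex.relabel] at h3 ⊢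
  exact List.length_pos_iff.1 (by omega)

theorem flatMap_ids_vertices (hg : ∀ w ∈ vertices k S D, g w.id = w.agents) :
    ((vertices k S D).map Vertex.id).flatMap g = k :: agentsIn D := by
  rw [List.flatMap_map, List.flatMap_congr hg]
  simp [vertices, flatMap_agents_numbered]

/-- Case 1: the shift empties `w_α`, puts one agent into `w_β` and keeps the size of every other
group, while the agents as a whole are only permuted. -/
theorem isUpdate_of_path_to_one (hD : ∀ P ∈ D, P.agents ≠ [])
    (hg : ∀ w ∈ vertices k S D, g w.id = w.agents)
    (h : IsPath ((vertices k S D).map Vertex.id) g p 1) :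
    IsUpdate v M N A t S k D (⟨[S], p.foldl moved g 1⟩ :: relabeled D (p.foldl moved g)) := by
  have h0 : g 0 = [k] := hg ⟨0, [], [k]⟩ (by simp [vertices])
  have h1 : g 1 = [] := hg ⟨1, [S], []⟩ (by simp [vertices])
  have hl := h.length_foldl_moved
  have hl0 : p.foldl moved g 0 = [] := by
    have := hl 0
    simpa [h0] using this
  refine ⟨?_, .inl ⟨?_, ?_⟩⟩
  · intro P hP
    rcases List.mem_cons.1 hP with rfl | hP
    · have := hl 1
      exact List.length_pos_iff.1 (by simp [h1] at this; simp [this])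
    · refine relabeled_agents_ne_nil hD hg (fun i hi => ?_) P hP
      have := hl i
      rwa [if_neg (by omega), if_neg (by omega)] at this
  · have := h.perm_flatMap nodup_map_id_vertices
    rw [flatMap_ids_vertices hg, map_id_vertices, List.flatMap_cons, List.flatMap_cons, hl0] at this
    rwa [agentsIn, List.flatMap_cons, ← agentsIn, agentsIn_relabeled]
  · rw [bundlesIn, List.flatMap_cons, ← bundlesIn, bundlesIn_relabeled]
    rfl

theorem perm_flatMap_erase {ids : List ℕ} (hids : ids.Nodup) (hw : w ∈ ids) {a : Fin n}
    (ha : a ∈ f w) :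
    (a :: ids.flatMap fun i => if i = w then (f i).erase a else f i).Perm (ids.flatMap f) := by
  have h1 : ids.Perm (w :: ids.erase w) := List.perm_cons_erase hw
  have h2 : ((ids.erase w).flatMap fun i => if i = w then (f i).erase a else f i) =
      (ids.erase w).flatMap f := by
    refine List.flatMap_congr fun i hi => if_neg ?_
    rintro rfl
    exact (List.nodup_cons.1 (h1.nodup_iff.1 hids)).1 hi
  refine ((h1.flatMap_right _).cons a).trans (List.Perm.trans ?_ (h1.flatMap_right _).symm)
  rw [List.flatMap_cons, List.flatMap_cons, h2, if_pos rfl]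
  exact (List.perm_cons_erase ha).symm.append_right _

/-- Case 2: the endpoint gains an agent from the shift and loses `a`, so every group of `D` keeps
its size. -/
theorem isUpdate_of_path_to_low (hD : ∀ P ∈ D, P.agents ≠ [])
    (hg : ∀ w ∈ vertices k S D, g w.id = w.agents) (hk : ¬Low v M N A t k) {a : Fin n}
    (ha : Low v M N A t a) (haw : a ∈ g w) (hw : w ∈ (vertices k S D).map Vertex.id)
    (h : IsPath ((vertices k S D).map Vertex.id) g p w) :
    IsUpdate v M N A t S k D (relabeled D fun i =>
      if i = w then (p.foldl moved g i).erase a else p.foldl moved g i) := by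
  have h0 : g 0 = [k] := hg ⟨0, [], [k]⟩ (by simp [vertices])
  have h1 : g 1 = [] := hg ⟨1, [S], []⟩ (by simp [vertices])
  have haf := h.subset_foldl_moved haw
  -- The only agent of `w_α` is `k`, who is not low; so the path is not empty and `w_α` does lose
  -- its agent.
  have hw0 : w ≠ 0 := by
    rintro rfl
    rw [h0, List.mem_singleton] at haw
    exact hk (haw ▸ ha)
  set f : ℕ → List (Fin n) := fun i =>
      if i = w then (p.foldl moved g i).erase a else p.foldl moved g i with hf
  have hl : ∀ i, (f i).length + (if i = 0 then 1 else 0) = (g i).length := by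
    intro i
    have := h.length_foldl_moved i
    by_cases hi : i = w
    · subst hi
      have := List.length_erase_add_one haf
      simp only [hf, if_true] at *
      omega
    · simp only [hf, hi, if_false] at *
      omega
  have hf0 : f 0 = [] := by simpa [h0] using hl 0
  have hf1 : f 1 = [] := by simpa [h1] using hl 1
  refine ⟨relabeled_agents_ne_nil hD hg fun i hi => ?_, .inr ⟨a, ha, ?_, ?_⟩⟩
  · simpa [show i ≠ 0 by omega] using hl i
  · have : (a :: ((vertices k S D).map Vertex.id).flatMap f).Perm _ :=
      (perm_flatMap_erase nodup_map_id_vertices hw haf).trans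
        (h.perm_flatMap nodup_map_id_vertices)
    rw [flatMap_ids_vertices hg, map_id_vertices, List.flatMap_cons, List.flatMap_cons, hf0,
      hf1] at this
    rwa [agentsIn_relabeled]
  · rw [bundlesIn_relabeled]

/-- Case 3: `w_β` is unseen and `w_α` is reached, so the sub-problems kept apart are exactly the
unseen vertices other than `w_β`. The merged group is nonempty because it contains `k`. -/
theorem isUpdate_of_merge (hD : ∀ P ∈ D, P.agents ≠ []) {R : List (Reached n m)}
    {unseen : List (Vertex n m)} (h : (R.map Reached.vertex ++ unseen).Perm (vertices k S D))
    (hu : unseen ⊆ ⟨1, [S], []⟩ :: numbered 2 D) (hR : ∀ x ∈ R, x.vertex.id ≠ 1) :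
    IsUpdate v M N A t S k D
      (⟨S :: (R.map Reached.vertex).flatMap (·.bundles),
        (R.map Reached.vertex).flatMap (·.agents)⟩ ::
          (unseen.filter (2 ≤ ·.id)).map Vertex.toSubproblem) := by
  have hβ : (⟨1, [S], []⟩ : Vertex n m) ∈ unseen := by
    have := h.symm.subset (show ⟨1, [S], []⟩ ∈ vertices k S D by simp [vertices])
    rcases List.mem_append.1 this with h' | h'
    · obtain ⟨x, hx, he⟩ := List.mem_map.1 h'
      exact (hR x hx (by rw [he])).elim
    · exact h'
  have hα : (⟨0, [], [k]⟩ : Vertex n m) ∈ R.map Reached.vertex := by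
    have := h.symm.subset (show ⟨0, [], [k]⟩ ∈ vertices k S D by simp [vertices])
    rcases List.mem_append.1 this with h' | h'
    · exact h'
    · rcases List.mem_cons.1 (hu h') with h'' | h''
      · simp at h''
      · have := le_id_of_mem_numbered h''
        simp at this
  obtain ⟨s, t', rfl⟩ := List.append_of_mem hβ
  have hnd := (h.map Vertex.id).nodup_iff.2 nodup_map_id_vertices
  have hst : ∀ w ∈ s ++ t', w ∈ numbered 2 D := by
    intro w hw
    have hw1 : w.id ≠ 1 := by
      rw [List.map_append] at hnd
      have h' := hnd.of_append_right
      rw [List.map_append, List.map_cons, List.nodup_middle, ← List.map_append,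
        List.nodup_cons] at h'
      intro he
      have hm : w.id ∈ (s ++ t').map Vertex.id := List.mem_map_of_mem hw
      rw [he] at hm
      exact h'.1 hm
    rcases List.mem_cons.1 (hu (show w ∈ s ++ ⟨1, [S], []⟩ :: t' by
      simp only [List.mem_append, List.mem_cons] at hw ⊢; tauto)) with rfl | h'
    · exact (hw1 rfl).elim
    · exact h'
  have hfil : (s ++ (⟨1, [S], []⟩ : Vertex n m) :: t').filter (2 ≤ ·.id) = s ++ t' := by
    rw [List.filter_append, List.filter_cons_of_neg (by simp), ← List.filter_append]
    exact List.filter_eq_self.2 fun w hw => by simpa using le_id_of_mem_numbered (hst w hw)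
  have hperm : (R.map Reached.vertex ++ (s ++ t')).Perm (⟨0, [], [k]⟩ :: numbered 2 D) := by
    refine (List.perm_cons (⟨1, [S], []⟩ : Vertex n m)).1 ?_
    refine List.Perm.trans ?_ (h.trans (List.Perm.swap _ _ _))
    rw [← List.append_assoc, ← List.append_assoc]
    exact List.perm_middle.symm
  rw [hfil]
  refine ⟨?_, .inl ⟨?_, ?_⟩⟩
  · intro P hP
    rcases List.mem_cons.1 hP with rfl | hP
    · exact List.ne_nil_of_mem (List.mem_flatMap.2 ⟨_, hα, List.mem_singleton.2 rfl⟩)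
    · obtain ⟨w, hw, rfl⟩ := List.mem_map.1 hP
      refine hD _ ?_
      have := List.mem_map_of_mem (f := Vertex.toSubproblem) (hst w hw)
      rwa [map_toSubproblem_numbered] at this
  · have := hperm.flatMap_right (·.agents)
    rw [List.flatMap_append, List.flatMap_cons, flatMap_agents_numbered] at this
    rw [agentsIn, List.flatMap_cons, ← agentsIn, ← flatMap_agents_eq]
    exact this
  · have := hperm.flatMap_right (·.bundles)
    rw [List.flatMap_append, List.flatMap_cons, flatMap_bundles_numbered] at this
    rw [bundlesIn, List.flatMap_cons, ← bundlesIn, ← flatMap_bundles_eq]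
    exact this.cons S

end Effects

theorem relabel_eq_self {g : ℕ → List (Fin n)} {V : List (Vertex n m)}
    (hg : ∀ w ∈ V, g w.id = w.agents) : V.map (Vertex.relabel g) = V := by
  conv_rhs => rw [← List.map_id V]
  exact List.map_congr_left fun w hw => by simp [Vertex.relabel, hg w hw]

theorem small_vertices (hS : S.length ≤ K) (hDa : (agentsIn D).length + 1 ≤ K)
    (hDb : SmallBundles K (bundlesIn D)) : ∀ w ∈ vertices k S D, w.Small K := by
  intro w hw
  simp only [vertices, List.mem_cons] at hw
  rcases hw with rfl | rfl | hw
  · exact ⟨by simp; omega, by simp, by simp⟩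
  · exact ⟨by simp, by simpa using hS, by simp; omega⟩
  · have h1 : w.agents.Sublist (agentsIn D) := by
      rw [← flatMap_agents_numbered 2 D]
      exact List.sublist_flatten_of_mem (List.mem_map_of_mem hw)
    have h2 : w.bundles.Sublist (bundlesIn D) := by
      rw [← flatMap_bundles_numbered 2 D]
      exact List.sublist_flatten_of_mem (List.mem_map_of_mem hw)
    exact ⟨by have := h1.length_le; omega, h2.flatten.length_le.trans hDb.1,
      h2.length_le.trans hDb.2⟩

theorem updateDecomposition_halts (hM : M.length ≤ K) (hA : SmallBundles K A) (hS : S.length ≤ K)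
    (hD : ∀ P ∈ D, P.agents ≠ []) (hDa : (agentsIn D).length + 1 ≤ K)
    (hDb : SmallBundles K (bundlesIn D)) (hk : ¬Low v M N A t k) {fuel : ℕ} (hfuel : K + 1 < fuel) :
    HaltsWithin (100 * (K + 1) ^ 4) (updateDecomposition v pick fuel M N A S t k D)
      (IsUpdate v M N A t S k D) := by
  obtain ⟨g, hg⟩ := exists_agents_vertices (nodup_map_id_vertices (k := k) (S := S) (D := D))
  have hsmall := small_vertices (k := k) hS hDa hDb
  have hDl := length_le_length_agentsIn hD
  have hVl : (vertices k S D).length = D.length + 2 := by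
    have := congrArg List.length (map_toSubproblem_numbered 2 D)
    simp only [List.length_map, vertices, List.length_cons] at *
    omega
  have hnl : (numbered 2 D).length = D.length := by
    simpa [vertices] using hVl
  have hV : (vertices k S D).map (Vertex.relabel g) = vertices k S D := relabel_eq_self hg
  have hstart : SearchState (vertices k S D) g [⟨⟨0, [], [k]⟩, []⟩]
      (⟨1, [S], []⟩ :: numbered 2 D) :=
    ⟨List.Perm.refl _, by simpa using IsPath.nil, by simp, by simp [vertices]⟩
  have hsrc : ∀ w, ∀ p, IsPath ((vertices k S D).map Vertex.id) g p w →
      ∀ e ∈ p, (g e.source).length ≤ K := by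
    intro w p h
    induction h with
    | nil => simp
    | @cons p b u w h hb hu hw huw hp ih =>
      intro e he
      rcases List.mem_cons.1 he with rfl | he
      · obtain ⟨x, hx, rfl⟩ := List.mem_map.1 hu
        rw [hg x hx]
        exact (hsmall x hx).1
      · exact ih e he
  -- `D` has at most `K - 1` sub-problems, so the graph has at most `K + 1` vertices. The budget
  -- after the search adds up the costs of the three cases instead of taking their maximum.
  refine .le (.tick (.bindEq (number_halts 2 D) (.bind (search_halts hM nodup_map_id_vertices hg
    hsmall (T := K + 1) (by omega) (by simp; omega) hstart) (b' := (K + 1) * 2 + 1 +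
      (((K + 1) * (K * (4 * K + 4) + 2 * K + 4) + 1) + (((K + 1) * K + 1) +
        ((K + 1) * ((K + 1) * (K + 2) + 2) + 1) + ((K + 1) * (K + 3) + 1) +
        ((K + 1) * (2 * K + 3) + 1) + (K + 3)))) fun R hR => ?_))) ?_
  · have hRV : ∀ x ∈ R.1, x.vertex ∈ vertices k S D := fun x hx =>
      hR.1.perm.subset (List.mem_append_left _ (List.mem_map_of_mem hx))
    have hRl : R.1.length + R.2.length = D.length + 2 := by
      rw [← hVl, ← hR.1.perm.length_eq]; simp
    have hmoves : ∀ x ∈ R.1, HaltsWithin ((K + 1) * ((K + 1) * (K + 2) + 2) + 1)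
        (applyMoves x.path (vertices k S D))
        (· = (vertices k S D).map (Vertex.relabel (x.path.foldl moved g))) := by
      intro x hx
      have h1 := applyMoves_halts (hR.1.isPath x hx) (hsrc _ _ (hR.1.isPath x hx)) (vertices k S D)
      rw [hV] at h1
      have h2 := hR.1.length_le x hx
      refine h1.le ?_
      gcongr <;> omega
    refine .bindEq (.le (reachedBeta_halts R.1) (by omega)) ?_
    generalize hB : R.1.filter (·.vertex.id = 1) = B
    rcases B with _ | ⟨y, B⟩
    · have hβ : ∀ x ∈ R.1, x.vertex.id ≠ 1 := by simpa using hB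
      refine .le (.bind (lowAgents_halts hM hA fun x hx => hsmall _ (hRV x hx))
        (b' := ((K + 1) * K + 1) + ((K + 1) * ((K + 1) * (K + 2) + 2) + 1) +
          ((K + 1) * (K + 3) + 1) + ((K + 1) * (2 * K + 3) + 1) + (K + 3)) fun L hL => ?_) ?_
      · rcases L with _ | ⟨y₀, L'⟩
        · refine .le (.bindEq (mergeReached_halts fun x hx => hsmall _ (hRV x hx))
            (.bindEq (subproblemsFrom_halts 2 R.2)
              (.ret (isUpdate_of_merge hD hR.1.perm hR.2 hβ)))) ?_
          have : R.1.length * (2 * K + 3) ≤ (K + 1) * (2 * K + 3) := by gcongr; omega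
          omega
        · refine .le (.bind (choose_halts pick y₀ L') fun y hy =>
            .bindEq (hmoves y.2 (hL.2 y hy).1) (.bindEq
              (dropAgent_halts (K := K + 1) y.1 y.2.vertex.id ?_ _)
              ((subproblemsFrom_two_halts _).imp ?_))) ?_
          -- The shift may have brought one extra agent to this vertex, hence the bound `K + 1`.
          · have h1 := (hR.1.isPath y.2 (hL.2 y hy).1).length_foldl_moved y.2.vertex.id
            have h2 := (hsmall _ (hRV _ (hL.2 y hy).1)).1
            rw [← hg _ (hRV _ (hL.2 y hy).1)] at h2
            rw [if_pos rfl] at h1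
            omega
          · rintro _ rfl
            obtain ⟨h1, h2, h3⟩ := hL.2 y hy
            refine isUpdate_of_path_to_low hD hg hk h3 ?_ (List.mem_map_of_mem (hRV _ h1))
              (hR.1.isPath _ h1)
            rwa [hg _ (hRV _ h1)]
          · have h1 : R.1.length * K ≤ (K + 1) * K := by gcongr; omega
            have h2 : (vertices k S D).length * (K + 1 + 2) ≤ (K + 1) * (K + 3) := by
              gcongr; omega
            have h3 := hL.1
            simp only [List.length_cons] at h3
            omega
      · have : R.1.length * (K * (4 * K + 4) + 2 * K + 4) ≤
          (K + 1) * (K * (4 * K + 4) + 2 * K + 4) := by gcongr; omega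
        omega
    · have hy : y ∈ R.1 ∧ y.vertex.id = 1 := by
        have : y ∈ R.1.filter (·.vertex.id = 1) := by rw [hB]; simp
        simpa using this
      have hp := hR.1.isPath y hy.1
      rw [hy.2] at hp
      refine .le (.bindEq (hmoves y hy.1) ((subproblemsFrom_one_halts _).imp ?_)) ?_
      swap
      · omega
      rintro _ rfl
      exact isUpdate_of_path_to_one hD hg hp
  · have h : (1 + (D.length + 1)) * ((K + 1) * (K * (4 * K + 4) + 2 * K + 6) + (K + 1) + 3) ≤
        (K + 1) * ((K + 1) * (K * (4 * K + 4) + 2 * K + 6) + (K + 1) + 3) :=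
      Nat.mul_le_mul_right _ (by omega)
    rw [List.length_singleton, List.length_cons, hnl]
    generalize (1 + (D.length + 1)) * ((K + 1) * (K * (4 * K + 4) + 2 * K + 6) + (K + 1) + 3) = y
      at h ⊢
    ring_nf at h ⊢
    omega

end Update

/-! ### The while loop and the for loop -/

section Loops

variable {n m : ℕ} {v : Fin n → Fin m → ℝ} {pick : ℕ → ℕ} {M : List (Fin m)} {N K : ℕ}
  {A : List (List (Fin m))} {t : ℕ} {S : List (Fin m)} {k : Fin n} {D D' : List (Subproblem n m)}
  {others NR : List (Fin n)} {before : List (List (Fin m))}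

variable (v M N A t) in
/-- The agents of a list whose value for `A`, divided by `t`, is above their share. -/
noncomputable def highAgents (l : List (Fin n)) : List (Fin n) :=
  l.filter fun k => decide (total v k M / (N : ℝ) < total v k A.flatten / (t : ℝ))

theorem length_highAgents_of_perm {l l' : List (Fin n)} (h : l.Perm l') :
    (highAgents v M N A t l).length = (highAgents v M N A t l').length :=
  (h.filter _).length_eq

theorem highAgents_cons_of_not_low (hk : ¬Low v M N A t k) (l : List (Fin n)) :
    highAgents v M N A t (k :: l) = k :: highAgents v M N A t l :=
  List.filter_cons_of_pos (by simpa [Low] using hk)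

theorem highAgents_cons_of_low (hk : Low v M N A t k) (l : List (Fin n)) :
    highAgents v M N A t (k :: l) = highAgents v M N A t l :=
  List.filter_cons_of_neg (by simpa [Low] using hk)

/-- The decomposition `D` matches as many of the agents `others` as there are bundles in `before`
with these bundles, and `NR` are the agents outside `D`. -/
structure LoopState (others : List (Fin n)) (before : List (List (Fin m)))
    (D : List (Subproblem n m)) (NR : List (Fin n)) : Prop where
  ne_nil : ∀ P ∈ D, P.agents ≠ []
  agents : (agentsIn D ++ NR).Perm others
  bundles : (bundlesIn D).Perm before
  length : (agentsIn D).length = before.length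

theorem LoopState.length_le (h : LoopState others before D NR) :
    (agentsIn D).length + NR.length = others.length := by
  simpa using h.agents.length_eq

/-- The recomputed list of non-participants agrees, up to order, with the list obtained by
bookkeeping. -/
theorem perm_filter_of_append_perm {a x : List (Fin n)} (hnd : others.Nodup)
    (h : (a ++ x).Perm others) : x.Perm (others.filter fun k => !decide (k ∈ a)) := by
  refine List.Perm.trans (.of_eq ?_) (h.filter _)
  have hd := (List.nodup_append.1 (h.nodup_iff.2 hnd)).2.2
  rw [List.filter_append, List.filter_eq_nil_iff.2 (by simp), List.nil_append]
  refine (List.filter_eq_self.2 fun k hk => ?_).symm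
  simpa using fun hk' => hd k hk' k hk rfl

/-- The high agent `k` leaves the outside. If somebody takes her place there, it is a low agent, who
does not count; so the potential drops by exactly one. -/
theorem LoopState.update (hnd : others.Nodup) (h : LoopState others before D NR) (hk : k ∈ NR)
    (hlow : ¬Low v M N A t k) (hu : IsUpdate v M N A t S k D D') {NR' : List (Fin n)}
    (hNR' : NR' = others.filter fun k => !decide (k ∈ agentsIn D')) :
    (LoopState others before D' NR' ∨ LoopState others (S :: before) D' NR') ∧
      (highAgents v M N A t NR').length + 1 = (highAgents v M N A t NR).length := by
  have hNR := List.perm_cons_erase hk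
  have hlen : (highAgents v M N A t NR).length =
      (highAgents v M N A t (NR.erase k)).length + 1 := by
    rw [length_highAgents_of_perm hNR, highAgents_cons_of_not_low hlow, List.length_cons]
  have hall : (k :: agentsIn D ++ NR.erase k).Perm others :=
    (List.perm_middle.symm.trans (hNR.symm.append_left _)).trans h.agents
  obtain ⟨hne, ⟨ha, hb⟩ | ⟨a, hal, ha, hb⟩⟩ := hu
  · have h1 := (ha.append_right _).trans hall
    have h2 := perm_filter_of_append_perm hnd h1
    rw [← hNR'] at h2
    refine ⟨.inr ⟨hne, (h2.symm.append_left _).trans h1, hb.trans (h.bundles.cons S), ?_⟩, ?_⟩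
    · rw [ha.length_eq, List.length_cons, List.length_cons, h.length]
    · rw [hlen, length_highAgents_of_perm h2]
  · have h1 : (agentsIn D' ++ a :: NR.erase k).Perm others :=
      List.perm_middle.trans ((ha.append_right _).trans hall)
    have h2 := perm_filter_of_append_perm hnd h1
    rw [← hNR'] at h2
    refine ⟨.inl ⟨hne, (h2.symm.append_left _).trans h1, hb.trans h.bundles, ?_⟩, ?_⟩
    · have := ha.length_eq
      rw [List.length_cons, List.length_cons, h.length] at this
      omega
    · rw [hlen, ← length_highAgents_of_perm h2, highAgents_cons_of_low hal]

theorem SmallBundles.of_perm {B : List (List (Fin m))} (hA : SmallBundles K A) (h : B.Perm A) :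
    SmallBundles K B :=
  ⟨h.flatten.length_eq.trans_le hA.1, h.length_eq.trans_le hA.2⟩

theorem SmallBundles.of_sublist {B : List (List (Fin m))} (hA : SmallBundles K A)
    (h : B.Sublist A) : SmallBundles K B :=
  ⟨h.flatten.length_le.trans hA.1, h.length_le.trans hA.2⟩

/-- The number of high agents outside bounds the remaining iterations. The extra `K + 2` in the fuel
is a reserve for the search inside each update, which receives the current fuel. -/
theorem whileLoop_halts (hM : M.length ≤ K) (hA : SmallBundles K (S :: before))
    (hnd : others.Nodup) (hothers : others.length + 1 ≤ K) (ht : t = before.length + 1) {fuel : ℕ}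
    (hfuel : (highAgents v M N (S :: before) t NR).length + K + 2 < fuel)
    (h : LoopState others before D NR ∨ LoopState others (S :: before) D NR) :
    HaltsWithin (((highAgents v M N (S :: before) t NR).length + 1) * (200 * (K + 1) ^ 4))
      (whileLoop v pick M N others (S :: before) S t fuel D NR)
      (fun r => LoopState others before r.1 r.2 ∨ LoopState others (S :: before) r.1 r.2) := by
  induction fuel generalizing D NR with
  | zero => omega
  | succ fuel ih =>
    have hsize : ∀ {D NR}, LoopState others before D NR ∨ LoopState others (S :: before) D NR →
        (agentsIn D).length + NR.length = others.length ∧ D.length ≤ (agentsIn D).length := by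
      rintro D NR (h | h) <;> exact ⟨h.length_le, length_le_length_agentsIn h.ne_nil⟩
    obtain ⟨h1, h2⟩ := hsize h
    have h3 : (highAgents v M N (S :: before) t NR).length ≤ NR.length := List.length_filter_le _ _
    have h4 : NR.length * (4 * K + 3 + 1) ≤ K * (4 * K + 3 + 1) := by gcongr; omega
    refine .le (.tick (.bindEq (x := highAgents v M N (S :: before) t NR)
      (select_halts fun k _ => aboveShare_halts hM hA t k)
      (.bindEq (agentsOf_halts D) (.bindEq (len_halts _)
      (b' := (highAgents v M N (S :: before) t NR).length * (200 * (K + 1) ^ 4) +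
        (100 * (K + 1) ^ 4 + (K * (K + 2) + 4 * K + 4))) ?_)))) ?_
    · generalize hC : highAgents v M N (S :: before) t NR = C at *
      rcases C with _ | ⟨k₀, C⟩
      · exact .le (.ret h) (Nat.zero_le _)
      · simp only
        split_ifs with hd
        -- Fewer than `t` participants means that `S` has not joined yet.
        · replace h : LoopState others before D NR := by
            refine h.resolve_right fun h' => ?_
            have := h'.length
            rw [List.length_cons] at this
            omega
          refine .le (.bind (choose_halts pick k₀ C) fun k hk => ?_) ?_ (b := C.length + 1 +
            (100 * (K + 1) ^ 4 + (K * (K + 2) + 3 * K + 3 + (C.length + 1) * (200 * (K + 1) ^ 4))))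
          · rw [← hC] at hk
            have hk' := List.mem_filter.1 hk
            have hlow : ¬Low v M N (S :: before) t k := by simpa [Low] using hk'.2
            refine .bind (updateDecomposition_halts hM hA ?_ h.ne_nil (by omega)
              ((hA.of_sublist (List.sublist_cons_self _ _)).of_perm h.bundles) hlow (by omega))
              fun D' hD' => ?_
            · exact le_trans (by simp) hA.1
            have hst := h.update hnd hk'.1 hlow hD' rfl
            obtain ⟨h5, h6⟩ := hsize hst.1
            have h7 : others.length * ((agentsIn D').length + 2) ≤ K * (K + 2) := by
              gcongr <;> omega
            have h8 := hst.2
            rw [hC, List.length_cons] at h8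
            simp only [List.length_cons] at hfuel
            refine .le (.bindEq (nonParticipants_halts others D') (ih (by omega) hst.1)) ?_
            rw [h8]
            omega
          · simp only [List.length_cons] at h3 ⊢
            omega
        · exact .le (.ret h) (Nat.zero_le _)
    · rw [add_one_mul]
      have : K * (4 * K + 3 + 1) + (K * (K + 2) + 4 * K + 4) + 4 * K + 5 ≤ 100 * (K + 1) ^ 4 := by
        ring_nf; omega
      omega

variable (others) in
/-- The divider's bundle, the decomposition and the bundles after the divider's one make up
`bundles`, and the decomposition and the agents outside it make up `others`. -/
structure IsSplit (bundles : List (List (Fin m))) (r : Split n m) : Prop where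
  ne_nil : ∀ P ∈ r.decomposition, P.agents ≠ []
  agents : (agentsIn r.decomposition ++ r.outside).Perm others
  bundles : (r.bundle :: bundlesIn r.decomposition ++ r.later).Perm bundles
  length : r.later.length = r.outside.length

/-- An iteration that does not stop ends with `S` in the decomposition and one more participant.
Counting bundles against agents excludes an exhausted list, and at the exit it gives as many later
bundles as agents outside. -/
theorem forLoop_halts (hM : M.length ≤ K) {rest : List (List (Fin m))}
    (hB : SmallBundles K (before ++ rest)) (hnd : others.Nodup)
    (hlen : before.length + rest.length = others.length + 1) (ht : t = before.length + 1)
    {fuel : ℕ} (hfuel : 2 * K + 2 < fuel) (h : LoopState others before D NR) :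
    HaltsWithin (rest.length * (300 * (K + 1) ^ 5))
      (forLoop v pick fuel M N others rest t before D NR)
      (IsSplit others (before ++ rest)) := by
  have hK : others.length + 1 ≤ K := by
    have := hB.2
    rw [List.length_append] at this
    omega
  induction rest generalizing before t D NR with
  | nil =>
    -- All bundles would be matched with equally many agents, one more than `others` contains.
    have h1 := h.length_le
    have h2 := h.length
    simp only [List.length_nil] at hlen
    omega
  | cons S later ih =>
    have hmid : (S :: before ++ later).Perm (before ++ S :: later) := List.perm_middle.symm
    have hS : SmallBundles K (S :: before) :=
      (hB.of_perm hmid).of_sublist (List.sublist_append_left _ _)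
    have h1 := h.length_le
    have h2 : (highAgents v M N (S :: before) t NR).length ≤ NR.length :=
      List.length_filter_le _ _
    refine .le (.tick (.bind (b := (K + 1) * (200 * (K + 1) ^ 4))
      (.le (whileLoop_halts hM hS hnd hK ht (by omega) (.inl h)) ?_) (b' := 4 * K + 2 +
        later.length * (300 * (K + 1) ^ 5)) fun r hr => ?_)) ?_
    · gcongr
      omega
    · have hsize : (agentsIn r.1).length + r.2.length = others.length ∧
          r.1.length ≤ (agentsIn r.1).length := by
        rcases hr with h | h <;> exact ⟨h.length_le, length_le_length_agentsIn h.ne_nil⟩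
      refine .le (.bindEq (agentsOf_halts r.1) (.bindEq (len_halts _)
        (b' := later.length * (300 * (K + 1) ^ 5)) ?_)) (by omega)
      split_ifs with hd
      · replace hr : LoopState others before r.1 r.2 := by
          refine hr.resolve_right fun h' => ?_
          have := h'.length
          rw [List.length_cons] at this
          omega
        refine .le (.ret ⟨hr.ne_nil, hr.agents, ?_, ?_⟩) (Nat.zero_le _)
        · exact ((hr.bundles.cons S).append_right _).trans hmid
        · have := hr.length
          simp only [List.length_cons] at hlen ⊢
          omega
      · replace hr : LoopState others (S :: before) r.1 r.2 := by
          refine hr.resolve_left fun h' => ?_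
          have := h'.length
          omega
        refine (ih (hB.of_perm hmid) ?_ ?_ hr).imp fun r' hr' =>
          ⟨hr'.ne_nil, hr'.agents, hr'.bundles.trans hmid, hr'.length⟩
        · simp only [List.length_cons] at hlen ⊢
          omega
        · rw [ht, List.length_cons]
    · rw [List.length_cons, add_one_mul later.length]
      have : (K + 1) * (200 * (K + 1) ^ 4) + 4 * K + 3 ≤ 300 * (K + 1) ^ 5 := by
        ring_nf; omega
      omega

end Loops

/-! ### The recursion -/

section Solve

variable {n m : ℕ} {v : Fin n → Fin m → ℝ} {pick : ℕ → ℕ} {K : ℕ}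

/-- Each of the agents `I` is listed once, and each of the goods `M` is in one of the bundles. -/
def IsAllocationOf (I : List (Fin n)) (M : List (Fin m)) (X : List (Fin n × List (Fin m))) : Prop :=
  (X.map Prod.fst).Perm I ∧ (X.map Prod.snd).flatten.Perm M

theorem IsAllocationOf.append {I J : List (Fin n)} {M M' : List (Fin m)}
    {X Y : List (Fin n × List (Fin m))} (hX : IsAllocationOf I M X) (hY : IsAllocationOf J M' Y) :
    IsAllocationOf (I ++ J) (M ++ M') (X ++ Y) := by
  constructor
  · rw [List.map_append]
    exact hX.1.append hY.1
  · rw [List.map_append, List.flatten_append]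
    exact hX.2.append hY.2

theorem IsAllocationOf.length_eq {I : List (Fin n)} {M : List (Fin m)}
    {X : List (Fin n × List (Fin m))} (hX : IsAllocationOf I M X) : X.length = I.length := by
  simpa using hX.1.length_eq

/-- A cost linear in the number of agents sums over disjoint groups to the same linear cost; the
constant terms are absorbed in the summand for the number of sub-problems. -/
theorem solveAll_halts {solveOne : List (Fin n) → List (Fin m) → Comp (List (Fin n × List (Fin m)))}
    {Q : ℕ} {D : List (Subproblem n m)} (ha : (agentsIn D).length ≤ K)
    (hb : SmallBundles K (bundlesIn D))
    (h : ∀ P ∈ D, HaltsWithin (P.agents.length * Q + 1) (solveOne P.agents P.bundles.flatten)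
      (IsAllocationOf P.agents P.bundles.flatten)) :
    HaltsWithin ((agentsIn D).length * Q + D.length * (4 * K + 4) + 1) (solveAll solveOne D)
      (IsAllocationOf (agentsIn D) (bundlesIn D).flatten) := by
  induction D with
  | nil => exact .le (.tick (.ret ⟨.refl _, .refl _⟩)) (by simp)
  | cons P D ih =>
    have h1 : agentsIn (P :: D) = P.agents ++ agentsIn D := by simp [agentsIn]
    have h2 : bundlesIn (P :: D) = P.bundles ++ bundlesIn D := by simp [bundlesIn]
    rw [h1, List.length_append] at ha
    rw [h2] at hb
    have h3 := hb.of_sublist (List.sublist_append_left _ _)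
    refine .le (.tick (.bindEq (concat_halts P.bundles) (.bind (h P (by simp)) fun x hx =>
      .bind (ih (by omega) (hb.of_sublist (List.sublist_append_right _ _))
        fun R hR => h R (by simp [hR])) fun y hy =>
      HaltsWithin.mono (b' := K + 1) (append_halts x y) ?_ ?_))) ?_
    · rw [hx.length_eq]
      omega
    · rintro _ rfl
      rw [h1, h2, List.flatten_append]
      exact hx.append hy
    · rw [h1, List.length_append, List.length_cons, add_mul, add_one_mul]
      have := h3.1
      have := h3.2
      omega

/-- Each recursive call has at least one agent fewer, which pays for the unit of fuel spent on
depth; the other `2 * K + 2` units remain for the loops. An empty group must come without goods,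
since nobody could receive them. -/
theorem solve_halts (hv : ∀ i j, 0 ≤ v i j) {fuel : ℕ} {I : List (Fin n)} {M : List (Fin m)}
    (hI : I.Nodup) (hIK : I.length ≤ K) (hMK : M.length ≤ K) (hIM : I = [] → M = [])
    (hfuel : I.length + 2 * K + 2 < fuel) :
    HaltsWithin (I.length * (400 * (K + 1) ^ 6) + 1) (solve v pick fuel I M)
      (IsAllocationOf I M) := by
  induction fuel generalizing I M with
  | zero => omega
  | succ fuel ih =>
    rcases I with _ | ⟨i₀, I⟩
    · rw [hIM rfl]
      exact .le (.tick (.ret ⟨.refl _, .refl _⟩)) (by simp)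
    · simp only [List.length_cons] at hIK hfuel
      refine .le (.tick (.bind (choose_halts pick i₀ I) fun i hi =>
        .bindEq (remove_halts i (i₀ :: I)) (.bindEq (len_halts _)
        (b' := K * (K + 2) + 1 + (K * (2 * K + 3) + 1 + (K * (300 * (K + 1) ^ 5) +
          (I.length * (400 * (K + 1) ^ 6) + (K * (4 * K + 4) + 1 + (3 * K + 1 + (K + 2))))))) ?_))) ?_
      · have hperm := List.perm_cons_erase hi
        generalize (i₀ :: I).erase i = others at *
        have hlen : others.length = I.length := by
          have := hperm.length_eq
          simp only [List.length_cons] at this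
          omega
        have hnd : others.Nodup := (List.nodup_cons.1 (hperm.nodup_iff.1 hI)).2
        refine .bind (.le (sortGoods_halts v i M) (by gcongr)) fun s hs => ?_
        have hsl : s.length ≤ K := hs.length_eq ▸ hMK
        refine .bind (.le (makeBundles_halts v i (hv i) _ s) (by
          rw [List.length_cons]; gcongr)) fun B hB => ?_
        have hBs : B.flatten = s := hB.2 (by simp)
        have hBl : B.length = I.length + 1 := by simpa using hB.1
        have hBK : SmallBundles K ([] ++ B) := ⟨by simpa [hBs] using hsl, by simp; omega⟩
        refine .bind (.le (forLoop_halts hMK hBK hnd (by simp; omega) rfl (by omega)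
          ⟨by simp, by simp [agentsIn], by simp [bundlesIn], by simp [agentsIn]⟩)
          (by gcongr; omega)) fun r hr => ?_
        have hra := hr.agents.length_eq
        rw [List.length_append] at hra
        have hrn := List.nodup_append.1 (hr.agents.nodup_iff.2 hnd)
        have hrb := hBK.of_perm hr.bundles
        have hrd : SmallBundles K (bundlesIn r.decomposition) :=
          hrb.of_sublist ((List.sublist_cons_self _ _).trans (List.sublist_append_left _ _))
        have hrl : SmallBundles K r.later := hrb.of_sublist (List.sublist_append_right _ _)
        have hDl := length_le_length_agentsIn hr.ne_nil
        have h1 : r.decomposition.length * (4 * K + 4) ≤ K * (4 * K + 4) := by gcongr; omega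
        -- The budget of the agents other than the divider splits exactly between the decomposition
        -- and the outside; the divider's own share pays for this call.
        have h2 : I.length * (400 * (K + 1) ^ 6) =
            (agentsIn r.decomposition).length * (400 * (K + 1) ^ 6) +
              r.outside.length * (400 * (K + 1) ^ 6) := by
          rw [← add_mul, hra, hlen]
        refine .le (.bind (solveAll_halts (K := K) (Q := 400 * (K + 1) ^ 6) (by omega) hrd
          fun P hP => ?_) (b' := 3 * K + 1 +
            (r.outside.length * (400 * (K + 1) ^ 6) + 1 + (K + 1 + 0))) fun X hX =>
          .bindEq (.le (concat_halts r.later) ?_)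
            (.bind (ih hrn.2.1 (by omega) hrl.1 ?_ (by omega)) fun Y hY =>
              .bindEq (.le (append_halts X Y) ?_) (.ret ?_))) (by omega)
        · have h3 : P.agents.Sublist (agentsIn r.decomposition) :=
            List.sublist_flatten_of_mem (List.mem_map_of_mem hP)
          have h4 : P.bundles.Sublist (bundlesIn r.decomposition) :=
            List.sublist_flatten_of_mem (List.mem_map_of_mem hP)
          have := h3.length_le
          exact ih (hrn.1.sublist h3) (by omega) (hrd.of_sublist h4).1
            (fun he => (hr.ne_nil P hP he).elim) (by omega)
        · have := hrl.1
          have := hrl.2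
          omega
        -- There are as many later bundles as agents outside, so an empty outside leaves no goods.
        · intro he
          have := hr.length
          rw [he, List.length_nil] at this
          rw [List.eq_nil_of_length_eq_zero this, List.flatten_nil]
        · rw [hX.length_eq]
          omega
        · have hXY := hX.append hY
          constructor
          · exact ((hXY.1.trans hr.agents).cons i).trans hperm.symm
          · rw [← List.flatten_append] at hXY
            have h3 := hr.bundles.flatten
            rw [List.nil_append, hBs] at h3
            exact (hXY.2.append_left r.bundle).trans (h3.trans hs.symm)
      · rw [List.length_cons, add_one_mul I.length]
        generalize I.length * (400 * (K + 1) ^ 6) = y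
        ring_nf
        omega

end Solve

end PROPm

/-! ### The polynomial bound -/

theorem mainTheorem2 :
    ∃ p : MvPolynomial (Fin 2) ℕ,
      ∀ (n m : ℕ) (v : Fin n → Fin m → ℝ) (pick : ℕ → ℕ), 0 < n → (∀ i j, 0 ≤ v i j) →
        ∃ (X : List (Fin n × List (Fin m))) (steps : ℕ),
          PROPm.RunsTo v pick X steps ∧ PROPm.IsAllocation X ∧
            steps ≤ MvPolynomial.eval ![n, m] p := by
  refine ⟨.X 0 * (400 * (.X 0 + .X 1 + 1) ^ 6) + 1, fun n m v pick hn hv => ?_⟩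
  -- The fuel is the least value that the bound on it allows; `0 < n` is what excludes goods without
  -- agents.
  obtain ⟨X, s, h, hs, hX⟩ := PROPm.solve_halts (pick := pick) (K := n + m)
    (fuel := n + 2 * (n + m) + 3) hv (List.nodup_finRange n) (by simp)
    (M := List.finRange m) (by simp) (by
      intro h
      have := congrArg List.length h
      simp only [List.length_finRange, List.length_nil] at this
      omega) (by simp) 0
  refine ⟨X, s, ⟨_, h⟩, hX, ?_⟩
  simpa using hs
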